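/- \textbf{Conventions.} A Stone space is a compact, Hausdorff, totally disconnected topological space. For a Boolean algebra $B$, let $E(B)$ be its Stone space: the set of ultrafilters on $B$, with the topology generated by the sets $U_b=\{\omega : b\in\omega\}$, $b\in B$. A Stone space $E$ has the Boolean algebra $\Omega(E)$ of clopen subsets; $E$ is second countable if and only if $\Omega(E)$ is countable. The group $\mathrm{Homeo}(E)$ carries the compact-open topology. The automorphism group of a Boolean algebra or of a graph carries the permutation topology, in which the pointwise stabilizers of finite sets of elements (respectively vertices) form a neighbourhood basis of the identity. A \emph{cut} in $B$ is an unordered pair $\{a,\lnot a\}$ with $a\in B$. It is \emph{non-peripheral} if neither $a$ nor $\lnot a$ is $0$ or an atom. Two cuts $\{a,\lnot a\}$ and $\{b,\lnot b\}$ \emph{cross} if all four elements $a\wedge b$, $a\wedge\lnot b$, $\lnot a\wedge b$, $\lnot a\wedge\lnot b$ are nonzero; otherwise they are \emph{compatible}. The \emph{complex of cuts} $\mathscr{C}(B)$ is the simple graph whose vertices are the non-peripheral cuts, with an edge between two distinct cuts whenever they are compatible. For a Stone space $E$ put $\mathscr{C}(E)=\mathscr{C}(\Omega(E))$; thus a vertex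 is a partition $E=U\sqcup V$ into two clopen sets with at least two points each, and two cuts $U\sqcup V$, $U'\sqcup V'$ cross if $U\cap U'$, $U\cap V'$, $V\cap U'$, $V\cap V'$ are all nonempty. \textbf{Theorem.} (1) Let $E$ be a second countable Stone space with at least five points. Then the natural maps \[ \mathrm{Homeo}(E)\to \mathrm{Aut}(\Omega(E)),\ f\mapsto (U\mapsto f(U)), \qquad \mathrm{Homeo}(E)\to \mathrm{Aut}(\mathscr{C}(E)),\ f\mapsto (U\sqcup V\mapsto f(U)\sqcup f(V)), \] are isomorphisms of topological groups. Moreover the graph $\mathscr{C}(E)$ is connected; if $E$ is finite, then $\mathscr{C}(E)$ is finite of diameter at most four; if $E$ is infinite, then $\mathscr{C}(E)$ has a countably infinite vertex set and diameter two. (2) Let $B$ be a countable Boolean algebra such that $E(B)$ has at least five points. Then the natural maps \[ \mathrm{Aut}(B)\to \mathrm{Homeo}(E(B)),\ \varphi\mapsto(\omega\mapsto\varphi(\omega)), \qquad \mathrm{Aut}(B)\to \mathrm{Aut}(\mathscr{C}(B)),\ \varphi\mapsto (\{a,\lnot a\}\mapsto\{\varphi(a),\lnot\varphi(a)\}), \]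 are isomorphisms of topological groups. -/

import Mathlib

open TopologicalSpace

/-! ### Topologies on automorphism groups -/

/-- The permutation topology on the automorphism group of a relational structure `(α, r)`:
the topology of pointwise convergence with `α` discrete.  It applies to `B ≃o B` and, for a
simple graph `G`, to `G ≃g G`. -/
instance permutationTopology {α : Type*} {r : α → α → Prop} : TopologicalSpace (r ≃r r) :=
  TopologicalSpace.induced (fun (φ : r ≃r r) (x : α) => φ x)
    (@Pi.topologicalSpace α (fun _ => α) (fun _ => ⊥))

theorem permutationTopology_continuous_iff {α X : Type*} [TopologicalSpace X]
    {r : α → α → Prop} (f : X → (r ≃r r)) :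
    Continuous f ↔ ∀ x y : α, IsOpen {t : X | f t x = y} := by
  let _ : TopologicalSpace α := ⊥
  have : DiscreteTopology α := ⟨rfl⟩
  rw [continuous_induced_rng, continuous_pi_iff]
  refine forall_congr' fun x => ?_
  rw [continuous_discrete_rng]
  rfl

theorem permutationTopology_isOpen {α : Type*} {r : α → α → Prop} (x y : α) :
    IsOpen {φ : r ≃r r | φ x = y} :=
  (permutationTopology_continuous_iff (fun φ : r ≃r r => φ)).1 continuous_id x y

/-- With the permutation topology, automorphism groups are topological groups. -/
instance permutationTopology_isTopologicalGroup {α : Type*} {r : α → α → Prop} :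
    IsTopologicalGroup (r ≃r r) where
  continuous_mul := by
    rw [permutationTopology_continuous_iff]
    intro x y
    have h : {t : (r ≃r r) × (r ≃r r) | (t.1 * t.2) x = y} =
        ⋃ z : α, {φ : r ≃r r | φ z = y} ×ˢ {φ : r ≃r r | φ x = z} := by
      ext ⟨φ, ψ⟩
      simp [RelIso.mul_apply]
    rw [h]
    exact isOpen_iUnion fun z =>
      (permutationTopology_isOpen z y).prod (permutationTopology_isOpen x z)
  continuous_inv := by
    rw [permutationTopology_continuous_iff]
    intro x y
    have h : {φ : r ≃r r | φ⁻¹ x = y} = {φ : r ≃r r | φ y = x} := by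
      ext φ
      constructor
      · rintro rfl; exact φ.apply_inv_self x
      · rintro rfl; exact φ.inv_apply_self y
    rw [h]
    exact permutationTopology_isOpen y x

/-- Neighbourhoods of the identity in the permutation topology are the sets that contain the
pointwise stabilizer of a finite set. -/
theorem mem_nhds_one_iff_stabilizer {α : Type*} {r : α → α → Prop} (s : Set (r ≃r r)) :
    s ∈ nhds (1 : r ≃r r) ↔ ∃ F : Finset α, {φ : r ≃r r | ∀ x ∈ F, φ x = x} ⊆ s := by
  let _ : TopologicalSpace α := ⊥
  have : DiscreteTopology α := ⟨rfl⟩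
  constructor
  · intro hs
    rw [nhds_induced, Filter.mem_comap] at hs
    obtain ⟨t, ht, hts⟩ := hs
    rw [nhds_pi, Filter.mem_pi] at ht
    obtain ⟨I, hI, u, hu, hut⟩ := ht
    refine ⟨hI.toFinset, fun φ hφ => hts (hut fun i hi => ?_)⟩
    have h1 : φ i = i := hφ i (by simpa using hi)
    have h2 := mem_of_mem_nhds (hu i)
    change φ i ∈ u i
    rw [h1]
    exact h2
  · rintro ⟨F, hF⟩
    refine Filter.mem_of_superset ?_ hF
    have h : {φ : r ≃r r | ∀ x ∈ F, φ x = x} = ⋂ x ∈ F, {φ : r ≃r r | φ x = x} := by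
      ext φ; simp
    rw [h]
    exact (isOpen_biInter_finset fun x _ => permutationTopology_isOpen x x).mem_nhds
      (by simp)

/-- The compact-open topology on the group of homeomorphisms of a space. -/
instance homeoCompactOpen {E : Type*} [TopologicalSpace E] : TopologicalSpace (E ≃ₜ E) :=
  TopologicalSpace.induced (fun f : E ≃ₜ E => (⟨f, f.continuous⟩ : C(E, E))) inferInstance

/-! ### The Boolean algebra of clopen sets and the space of ultrafilters -/

/-- The image of a clopen set under a homeomorphism. -/
def imageClopen {E : Type*} [TopologicalSpace E] (f : E ≃ₜ E) (U : Clopens E) : Clopens E :=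
  ⟨f '' (U : Set E), f.isClosedMap _ U.isClopen.isClosed, f.isOpenMap _ U.isClopen.isOpen⟩

/-- `Homeo(E) → Aut(Ω(E))`, `f ↦ (U ↦ f(U))`, where `Ω(E)` is the Boolean algebra of clopen
sets.  Automorphisms of a Boolean algebra are the same as its order automorphisms. -/
def clopenAction (E : Type*) [TopologicalSpace E] : (E ≃ₜ E) →* (Clopens E ≃o Clopens E) where
  toFun f :=
    { toFun := imageClopen f
      invFun := imageClopen f.symm
      left_inv := fun U => Clopens.ext (f.toEquiv.symm_image_image U)
      right_inv := fun U => Clopens.ext (f.toEquiv.image_symm_image U)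
      map_rel_iff' := by
        intro U V
        exact Set.image_subset_image_iff f.injective }
  map_one' := RelIso.ext fun U => Clopens.ext (Set.image_id _)
  map_mul' f g := RelIso.ext fun U => Clopens.ext (Set.image_comp f g _)

/-- The Stone space `E(B)`: ultrafilters on `B`, i.e. maximal proper filters. -/
def StoneSpace (B : Type*) [BooleanAlgebra B] : Type _ :=
  {ω : Order.PFilter B // Maximal (fun F : Order.PFilter B => (F : Set B) ≠ Set.univ) ω}

/-- The topology on `E(B)` generated by the sets `U_b = {ω | b ∈ ω}`. -/
instance stoneTopology (B : Type*) [BooleanAlgebra B] : TopologicalSpace (StoneSpace B) :=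
  TopologicalSpace.generateFrom (Set.range fun b : B => {ω : StoneSpace B | b ∈ ω.1})

/-- The image `{φ b | b ∈ F}` of a filter under an automorphism. -/
def mapFilter {B : Type*} [BooleanAlgebra B] (φ : B ≃o B) (F : Order.PFilter B) :
    Order.PFilter B :=
  Order.IsPFilter.toPFilter (F := φ '' (F : Set B)) <| by
    refine Order.IsPFilter.of_def (F.nonempty.image _) ?_ ?_
    · rintro _ ⟨a, ha, rfl⟩ _ ⟨b, hb, rfl⟩
      obtain ⟨c, hc, h1, h2⟩ := F.directed a ha b hb
      exact ⟨φ c, ⟨c, hc, rfl⟩, φ.monotone h1, φ.monotone h2⟩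
    · rintro _ y h ⟨a, ha, rfl⟩
      exact ⟨φ.symm y, Order.PFilter.mem_of_le (by simpa using φ.symm.monotone h) ha, by simp⟩

theorem coe_mapFilter {B : Type*} [BooleanAlgebra B] (φ : B ≃o B) (F : Order.PFilter B) :
    (mapFilter φ F : Set B) = φ '' (F : Set B) := rfl

theorem mapFilter_symm {B : Type*} [BooleanAlgebra B] (φ : B ≃o B) (F : Order.PFilter B) :
    mapFilter φ (mapFilter φ.symm F) = F :=
  Order.PFilter.ext _ _ (φ.toEquiv.image_symm_image F)

theorem mapFilter_mono {B : Type*} [BooleanAlgebra B] (φ : B ≃o B) {F G : Order.PFilter B}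
    (h : F ≤ G) : mapFilter φ F ≤ mapFilter φ G :=
  Set.image_mono h

theorem mapFilter_proper {B : Type*} [BooleanAlgebra B] (φ : B ≃o B) {F : Order.PFilter B}
    (h : (F : Set B) ≠ Set.univ) : (mapFilter φ F : Set B) ≠ Set.univ := by
  intro h'
  apply h
  rw [coe_mapFilter] at h'
  rw [Set.eq_univ_iff_forall] at h' ⊢
  intro b
  obtain ⟨a, ha, hab⟩ := h' (φ b)
  rwa [← φ.injective hab]

/-- The image `{φ b | b ∈ ω}` of an ultrafilter under an automorphism. -/
def mapUltrafilter {B : Type*} [BooleanAlgebra B] (φ : B ≃o B) (ω : StoneSpace B) :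
    StoneSpace B :=
  ⟨mapFilter φ ω.1, mapFilter_proper φ ω.2.1, fun G hG h => by
    have h1 : ω.1 ≤ mapFilter φ.symm G := by
      have := mapFilter_mono φ.symm h
      rwa [show mapFilter φ.symm (mapFilter φ ω.1) = ω.1 from mapFilter_symm φ.symm ω.1] at this
    have h2 := mapFilter_mono φ (ω.2.2 (mapFilter_proper φ.symm hG) h1)
    rwa [mapFilter_symm] at h2⟩

theorem mapUltrafilter_continuous {B : Type*} [BooleanAlgebra B] (φ : B ≃o B) :
    Continuous (mapUltrafilter φ) := by
  refine continuous_generateFrom_iff.2 ?_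
  rintro _ ⟨b, rfl⟩
  refine isOpen_generateFrom_of_mem ⟨φ.symm b, ?_⟩
  ext ω
  change φ.symm b ∈ ω.1 ↔ b ∈ φ '' (ω.1 : Set B)
  constructor
  · intro h
    exact ⟨_, h, by simp⟩
  · rintro ⟨a, ha, rfl⟩
    simpa using ha

/-- `Aut(B) → Homeo(E(B))`, `φ ↦ (ω ↦ φ(ω))`. -/
def stoneAction (B : Type*) [BooleanAlgebra B] : (B ≃o B) →* (StoneSpace B ≃ₜ StoneSpace B) where
  toFun φ :=
    { toFun := mapUltrafilter φ
      invFun := mapUltrafilter φ.symm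
      left_inv := fun ω => Subtype.ext (mapFilter_symm φ.symm ω.1)
      right_inv := fun ω => Subtype.ext (mapFilter_symm φ ω.1)
      continuous_toFun := mapUltrafilter_continuous φ
      continuous_invFun := mapUltrafilter_continuous φ.symm }
  map_one' := Homeomorph.ext fun _ => Subtype.ext (Order.PFilter.ext _ _ (Set.image_id _))
  map_mul' φ ψ := Homeomorph.ext fun _ => Subtype.ext (Order.PFilter.ext _ _ (Set.image_comp φ ψ _))

/-! ### The complex of cuts -/

/-- A cut of `B`: an unordered pair `{a, ¬a}`. -/
def IsCut {B : Type*} [BooleanAlgebra B] (s : Sym2 B) : Prop := ∃ a : B, s = s(a, aᶜ)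

/-- Neither side is `0` or an atom. -/
def IsNonperipheral {B : Type*} [BooleanAlgebra B] (s : Sym2 B) : Prop :=
  ∀ a ∈ s, a ≠ ⊥ ∧ ¬ IsAtom a

/-- Two cuts cross if all four meets of a side of one with a side of the other are nonzero. -/
def Crosses {B : Type*} [BooleanAlgebra B] (s t : Sym2 B) : Prop :=
  ∀ a ∈ s, ∀ b ∈ t, a ⊓ b ≠ ⊥

/-- The non-peripheral cuts of `B`. -/
def CutVertex (B : Type*) [BooleanAlgebra B] : Type _ :=
  {s : Sym2 B // IsCut s ∧ IsNonperipheral s}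

/-- The complex of cuts `𝒞(B)`: its vertices are the non-peripheral cuts, and distinct cuts are
adjacent when they are compatible, i.e. do not cross.  For a Stone space `E` the complex `𝒞(E)`
is `cutComplex (Clopens E)`; see `isNonperipheral_clopens_iff` and `crosses_clopens_iff`. -/
def cutComplex (B : Type*) [BooleanAlgebra B] : SimpleGraph (CutVertex B) where
  Adj s t := s ≠ t ∧ ¬ Crosses s.1 t.1
  symm := ⟨fun s t h => ⟨h.1.symm, fun h' => h.2 fun a ha b hb => by
    rw [inf_comm]; exact h' b hb a ha⟩⟩
  loopless := ⟨fun _ h => h.1 rfl⟩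

/-- In a Stone space, a cut `U ⊔ V` is non-peripheral iff `U` and `V` each contain at least two
points. -/
theorem isNonperipheral_clopens_iff {E : Type*} [TopologicalSpace E] [CompactSpace E] [T2Space E]
    [TotallyDisconnectedSpace E] (s : Sym2 (Clopens E)) :
    IsNonperipheral s ↔ ∀ U ∈ s, (U : Set E).Nontrivial := by
  refine forall_congr' fun U => imp_congr_right fun _ => ?_
  constructor
  · rintro ⟨h0, h1⟩
    by_contra h
    rw [Set.not_nontrivial_iff] at h
    refine h1 ⟨h0, fun V hV => ?_⟩
    refine Clopens.ext (Set.eq_empty_of_forall_notMem fun x hx => hV.not_ge ?_)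
    intro y hy
    rwa [h hy (hV.le hx)]
  · rintro ⟨x, hx, y, hy, hxy⟩
    refine ⟨fun h => by rw [h] at hx; exact hx, fun h => ?_⟩
    obtain ⟨V, hV, hxV, hVy⟩ := exists_isClopen_of_totally_separated (α := E) hxy
    have hle : U ⊓ ⟨V, hV⟩ ≤ U := inf_le_left
    rcases h.le_iff.1 hle with h2 | h2
    · have : x ∈ U ⊓ ⟨V, hV⟩ := ⟨hx, hxV⟩
      rw [h2] at this
      exact this
    · have : y ∈ U ⊓ ⟨V, hV⟩ := by rw [h2]; exact hy
      exact hVy this.2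

/-- Two cuts of a space cross iff all four intersections of their sides are nonempty. -/
theorem crosses_clopens_iff {E : Type*} [TopologicalSpace E] (s t : Sym2 (Clopens E)) :
    Crosses s t ↔ ∀ U ∈ s, ∀ V ∈ t, ((U : Set E) ∩ (V : Set E)).Nonempty := by
  refine forall₂_congr fun U _ => forall₂_congr fun V _ => ?_
  rw [Set.nonempty_iff_ne_empty, not_iff_not, SetLike.ext'_iff]
  rfl

theorem map_isCut {B : Type*} [BooleanAlgebra B] (φ : B ≃o B) {s : Sym2 B} (h : IsCut s) :
    IsCut (s.map φ) := by
  obtain ⟨a, rfl⟩ := h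
  exact ⟨φ a, by simp⟩

theorem map_isNonperipheral {B : Type*} [BooleanAlgebra B] (φ : B ≃o B) {s : Sym2 B}
    (h : IsNonperipheral s) : IsNonperipheral (s.map φ) := by
  intro b hb
  obtain ⟨a, ha, rfl⟩ := Sym2.mem_map.1 hb
  exact ⟨by simpa using (h a ha).1, by simpa using (h a ha).2⟩

theorem map_crosses_iff {B : Type*} [BooleanAlgebra B] (φ : B ≃o B) (s t : Sym2 B) :
    Crosses (s.map φ) (t.map φ) ↔ Crosses s t := by
  simp only [Crosses, Sym2.mem_map, forall_exists_index, and_imp, forall_apply_eq_imp_iff₂,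
    ← map_inf, ne_eq, map_eq_bot_iff]

/-- The action of an automorphism on cuts, `{a, ¬a} ↦ {φ a, ¬φ a}`. -/
def mapCut {B : Type*} [BooleanAlgebra B] (φ : B ≃o B) (s : CutVertex B) : CutVertex B :=
  ⟨s.1.map φ, map_isCut φ s.2.1, map_isNonperipheral φ s.2.2⟩

theorem mapCut_symm {B : Type*} [BooleanAlgebra B] (φ : B ≃o B) (s : CutVertex B) :
    mapCut φ (mapCut φ.symm s) = s :=
  Subtype.ext <| by
    change Sym2.map φ (Sym2.map φ.symm s.1) = s.1
    rw [Sym2.map_map, show (φ ∘ φ.symm : B → B) = id from funext φ.apply_symm_apply, Sym2.map_id]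
    rfl

/-- The natural map `Aut(B) → Aut(𝒞(B))`. -/
def autCutAction (B : Type*) [BooleanAlgebra B] :
    (B ≃o B) →* (cutComplex B ≃g cutComplex B) where
  toFun φ :=
    { toFun := mapCut φ
      invFun := mapCut φ.symm
      left_inv := mapCut_symm φ.symm
      right_inv := mapCut_symm φ
      map_rel_iff' := by
        intro s t
        refine and_congr (not_congr ?_) (not_congr (map_crosses_iff φ s.1 t.1))
        refine ⟨fun h => ?_, fun h => congrArg (mapCut φ) h⟩
        have h' := congrArg (mapCut φ.symm) h
        exact (mapCut_symm φ.symm s).symm.trans (h'.trans (mapCut_symm φ.symm t)) }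
  map_one' := RelIso.ext fun s => Subtype.ext <| by
    change Sym2.map id s.1 = s.1
    simp
  map_mul' φ ψ := RelIso.ext fun s => Subtype.ext (Sym2.map_map (g := φ) (f := ψ) s.1).symm

/-- The natural map `Homeo(E) → Aut(𝒞(E))`, `U ⊔ V ↦ f(U) ⊔ f(V)`. -/
def homeoCutAction (E : Type*) [TopologicalSpace E] :
    (E ≃ₜ E) →* (cutComplex (Clopens E) ≃g cutComplex (Clopens E)) :=
  (autCutAction (Clopens E)).comp (clopenAction E)

/-- The homomorphism `f` is an isomorphism of topological groups. -/
def IsTopGroupIso {G H : Type*} [Group G] [TopologicalSpace G] [Group H] [TopologicalSpace H]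
    (f : G →* H) : Prop :=
  ∃ e : G ≃ₜ* H, ∀ g, e g = f g

/-!
Call an element of `B` a side if it is one of the two members of a vertex `{a, ¬a}`. The sides
form a poset, and the link of the vertex `{a, ¬a}` is the disjoint union of two halves: the cuts
with a side strictly below `a` and those with a side strictly below `¬a`. Cuts in different halves
never cross, while any two cuts in the same half are crossed by a common third cut of that half.
So the graph knows the halves, hence which of them belongs to which side, and `a < b` means that
the cut of `a` lies in the half of `b` while the cut of `b` lies in the half of `¬a`. An isomorphism
of complexes therefore lifts to an isomorphism of the posets of sides that commutes with
complements.

With five points, every element of `B` is a finite join of meets `a ⊓ b` of two sides, and the poset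
of sides determines whether two such meets are disjoint, so the isomorphism extends uniquely to `B`.
Stone duality turns automorphisms of `B` into homeomorphisms.

For the distances, any two cuts have sides whose meet contains two points; that meet is itself a
side, and its cut is equal or adjacent to both.
-/

section BooleanAlgebra

variable {B : Type*} [BooleanAlgebra B] {a b c x : B}

/-- An element that is neither `0` nor an atom, i.e. whose clopen set in the Stone space contains
at least two points. -/
def IsThick (a : B) : Prop := a ≠ ⊥ ∧ ¬ IsAtom a

theorem isThick_iff_exists_lt : IsThick a ↔ ∃ b, b ≠ ⊥ ∧ b < a := by
  constructor
  · rintro ⟨ha, hatom⟩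
    simp only [IsAtom, not_and, not_forall] at hatom
    obtain ⟨b, hba, hb⟩ := hatom ha
    exact ⟨b, hb, hba⟩
  · rintro ⟨b, hb, hba⟩
    exact ⟨hba.ne_bot, fun ha => hb (ha.2 b hba)⟩

theorem IsThick.mono (ha : IsThick a) (h : a ≤ b) : IsThick b := by
  obtain ⟨c, hc, hca⟩ := isThick_iff_exists_lt.1 ha
  exact isThick_iff_exists_lt.2 ⟨c, hc, hca.trans_le h⟩

theorem isThick_sup_of_disjoint (ha : a ≠ ⊥) (hb : b ≠ ⊥) (h : Disjoint a b) :
    IsThick (a ⊔ b) :=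
  isThick_iff_exists_lt.2
    ⟨a, ha, left_lt_sup.2 fun hba => hb (h.eq_bot_of_ge hba)⟩

theorem isAtom_of_not_isThick (ha : a ≠ ⊥) (h : ¬ IsThick a) : IsAtom a :=
  of_not_not fun hatom => h ⟨ha, hatom⟩

theorem isThick_map_iff {C : Type*} [BooleanAlgebra C] (e : B ≃o C) :
    IsThick (e a) ↔ IsThick a := by
  simp only [IsThick, ne_eq, map_eq_bot_iff, OrderIso.isAtom_iff]

theorem IsThick.exists_lt_of_le (hb : IsThick b) (ha : a ≠ ⊥) (hab : a ≤ b) :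
    ∃ p, p ≠ ⊥ ∧ p ≤ a ∧ p < b := by
  rcases hab.lt_or_eq with h | rfl
  · exact ⟨a, ha, le_rfl, h⟩
  · obtain ⟨p, hp, hpa⟩ := isThick_iff_exists_lt.1 hb
    exact ⟨p, hp, hpa.le, hpa⟩

/-- The Stone space of `B` has at least five points. Said inside `B`: four elements each of which
is `0` or an atom never cover `B`. -/
def HasFivePoints (B : Type*) [BooleanAlgebra B] : Prop :=
  ∀ a b c d : B, a ⊔ b ⊔ c ⊔ d = ⊤ → IsThick a ∨ IsThick b ∨ IsThick c ∨ IsThick d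

theorem HasFivePoints.of_orderIso {C : Type*} [BooleanAlgebra C] (e : B ≃o C)
    (h : HasFivePoints B) : HasFivePoints C := fun a b c d habcd => by
  have hcover := h (e.symm a) (e.symm b) (e.symm c) (e.symm d)
    (by rw [← map_sup, ← map_sup, ← map_sup, habcd, map_top])
  simpa only [isThick_map_iff] using hcover

namespace HasFivePoints

theorem exists_isThick_lt (h : HasFivePoints B) (hx : ¬ IsThick xᶜ) : ∃ a, IsThick a ∧ a < x := by
  have hxthick : IsThick x := by
    have := h x xᶜ ⊥ ⊥ (by simp)
    have hbot : ¬ IsThick (⊥ : B) := fun hbot => hbot.1 rfl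
    tauto
  obtain ⟨p, hp, hpx⟩ := isThick_iff_exists_lt.1 hxthick
  have hcover : p ⊔ x \ p ⊔ xᶜ ⊔ ⊥ = ⊤ := by
    rw [sup_sdiff_cancel_right hpx.le, sup_compl_eq_top, top_sup_eq]
  rcases h _ _ _ _ hcover with hthick | hthick | hthick | hthick
  · exact ⟨p, hthick, hpx⟩
  · exact ⟨x \ p, hthick, sdiff_lt hpx.le hp⟩
  · exact absurd hthick hx
  · exact absurd rfl hthick.1

theorem exists_isThick_disjoint_sup_eq (h : HasFivePoints B) (hx : ¬ IsThick xᶜ) :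
    ∃ a b, IsThick a ∧ IsThick b ∧ Disjoint a b ∧ a ⊔ b = x := by
  obtain ⟨a, ha, hax⟩ := h.exists_isThick_lt hx
  by_cases hthick : IsThick (x \ a)
  · exact ⟨a, x \ a, ha, hthick, disjoint_sdiff_self_right, sup_sdiff_cancel_right hax.le⟩
  obtain ⟨p, hp, hpa⟩ := isThick_iff_exists_lt.1 ha
  have hcover : p ⊔ a \ p ⊔ x \ a ⊔ xᶜ = ⊤ := by
    rw [sup_sdiff_cancel_right hpa.le, sup_sdiff_cancel_right hax.le, sup_compl_eq_top]
  obtain ⟨c, hc, hca⟩ : ∃ c, IsThick c ∧ c < a := by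
    rcases h _ _ _ _ hcover with hc | hc | hc | hc
    · exact ⟨p, hc, hpa⟩
    · exact ⟨a \ p, hc, sdiff_lt hpa.le hp⟩
    · exact absurd hc hthick
    · exact absurd hc hx
  refine ⟨c, x \ c, hc, ?_, disjoint_sdiff_self_right, sup_sdiff_cancel_right (hca.trans hax).le⟩
  have hsplit : a \ c ⊔ x \ a ≤ x \ c :=
    sup_le (sdiff_le_sdiff_right hax.le) (sdiff_le_sdiff_left hca.le)
  refine (isThick_sup_of_disjoint ?_ ?_ ?_).mono hsplit
  · exact fun hac => hca.not_ge (sdiff_eq_bot_iff.1 hac)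
  · exact fun hxa => hax.not_ge (sdiff_eq_bot_iff.1 hxa)
  · exact disjoint_sdiff_self_right.mono_left sdiff_le

end HasFivePoints

theorem le_iff_forall_disjoint {ι : Type*} {f : ι → B} (hf : ∀ x, ∃ F : Finset ι, F.sup f = x)
    {x y : B} : x ≤ y ↔ ∀ i, Disjoint (f i) y → Disjoint (f i) x := by
  refine ⟨fun hxy i hi => hi.mono_right hxy, fun h => ?_⟩
  obtain ⟨F, hF⟩ := hf (x \ y)
  have hdisj : Disjoint (x \ y) x := by
    rw [← hF, Finset.disjoint_sup_left]
    intro i hi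
    have hle : f i ≤ x \ y := hF ▸ Finset.le_sup hi
    exact h i (disjoint_sdiff_self_left.mono_left hle)
  exact sdiff_eq_bot_iff.1 (hdisj.eq_bot_of_le sdiff_le)

theorem exists_orderIso_of_disjoint_iff {C ι : Type*} [BooleanAlgebra C] {f : ι → B} {g : ι → C}
    (hf : ∀ x, ∃ F : Finset ι, F.sup f = x) (hg : ∀ y, ∃ F : Finset ι, F.sup g = y)
    (hfg : ∀ i j, Disjoint (f i) (f j) ↔ Disjoint (g i) (g j)) :
    ∃ φ : B ≃o C, ∀ i, φ (f i) = g i := by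
  have hle (F G : Finset ι) : F.sup g ≤ G.sup g ↔ F.sup f ≤ G.sup f := by
    simp only [le_iff_forall_disjoint hf, le_iff_forall_disjoint hg, Finset.disjoint_sup_right, hfg]
  have heq {F G : Finset ι} (h : F.sup f = G.sup f) : F.sup g = G.sup g :=
    ((hle F G).2 h.le).antisymm ((hle G F).2 h.ge)
  choose F hF using hf
  let φ : B ↪o C := .ofMapLEIff (fun x => (F x).sup g) fun x y => by rw [hle, hF, hF]
  have hφ (G : Finset ι) : φ (G.sup f) = G.sup g := heq (hF _)
  refine ⟨RelIso.ofSurjective φ fun y => ?_, fun i => ?_⟩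
  · obtain ⟨G, rfl⟩ := hg y
    exact ⟨G.sup f, hφ G⟩
  · change φ (f i) = g i
    simpa using hφ {i}

end BooleanAlgebra

section Sides

variable {B C : Type*} [BooleanAlgebra B] [BooleanAlgebra C]

/-- The sides of the non-peripheral cuts, ordered as elements of `B`. Every vertex of the complex
of cuts is `{a, ¬a}` for exactly two sides `a`. -/
abbrev Side (B : Type*) [BooleanAlgebra B] : Type _ := {a : B // IsThick a ∧ IsThick aᶜ}

namespace Side

variable {a b c d m : Side B} {x : B}

instance : Compl (Side B) := ⟨fun a => ⟨aᶜ, a.2.2, by rw [compl_compl]; exact a.2.1⟩⟩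

theorem coe_compl (a : Side B) : ((aᶜ : Side B) : B) = (a : B)ᶜ := rfl

theorem compl_compl (a : Side B) : aᶜᶜ = a := Subtype.ext (_root_.compl_compl (a : B))

theorem isThick_compl_of_le (a : Side B) (h : x ≤ a) : IsThick xᶜ := a.2.2.mono (compl_le_compl h)

theorem le_compl_iff_disjoint : a ≤ bᶜ ↔ Disjoint (a : B) b :=
  _root_.le_compl_iff_disjoint_right

theorem isGLB_pair_iff : IsGLB {a, b} m ↔ (a ⊓ b : B) = m := by
  constructor
  · intro h
    have hma : m ≤ a := h.1 (by simp)
    have hmb : m ≤ b := h.1 (by simp)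
    have hle : (m : B) ≤ (a ⊓ b : B) := le_inf hma hmb
    let n : Side B := ⟨a ⊓ b, m.2.1.mono hle, a.isThick_compl_of_le inf_le_left⟩
    have hn : n ∈ lowerBounds {a, b} := by
      rintro _ (rfl | rfl)
      exacts [inf_le_left, inf_le_right]
    exact le_antisymm (h.2 hn) hle
  · intro h
    refine ⟨?_, fun n hn => Subtype.coe_le_coe.1 ?_⟩
    · rintro _ (rfl | rfl)
      exacts [Subtype.coe_le_coe.1 (h ▸ inf_le_left), Subtype.coe_le_coe.1 (h ▸ inf_le_right)]
    · rw [← h]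
      exact le_inf (hn (Set.mem_insert a _)) (hn (Set.mem_insert_of_mem a rfl))

theorem isLUB_pair_iff : IsLUB {a, b} m ↔ (a ⊔ b : B) = m := by
  constructor
  · intro h
    have ham : a ≤ m := h.1 (by simp)
    have hbm : b ≤ m := h.1 (by simp)
    have hle : (a ⊔ b : B) ≤ m := sup_le ham hbm
    let n : Side B := ⟨a ⊔ b, a.2.1.mono le_sup_left, m.isThick_compl_of_le hle⟩
    have hn : n ∈ upperBounds {a, b} := by
      rintro _ (rfl | rfl)
      exacts [le_sup_left, le_sup_right]
    exact hle.antisymm (h.2 hn)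
  · intro h
    refine ⟨?_, fun n hn => Subtype.coe_le_coe.1 ?_⟩
    · rintro _ (rfl | rfl)
      exacts [Subtype.coe_le_coe.1 (h ▸ le_sup_left), Subtype.coe_le_coe.1 (h ▸ le_sup_right)]
    · rw [← h]
      exact sup_le (hn (Set.mem_insert a _)) (hn (Set.mem_insert_of_mem a rfl))

end Side

namespace HasFivePoints

variable {x : B}

theorem exists_sides_sup_eq (h : HasFivePoints B) (hx : ¬ IsThick xᶜ) :
    ∃ a b : Side B, (a ⊔ b : B) = x := by
  obtain ⟨a, b, ha, hb, hab, rfl⟩ := h.exists_isThick_disjoint_sup_eq hx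
  exact ⟨⟨a, ha, hb.mono hab.le_compl_left⟩, ⟨b, hb, ha.mono hab.le_compl_right⟩, rfl⟩

theorem exists_sides_inf_eq (h : HasFivePoints B) (hx : ¬ IsThick x) :
    ∃ a b : Side B, (a ⊓ b : B) = x := by
  obtain ⟨a, b, hab⟩ := h.exists_sides_sup_eq (x := xᶜ) (by rwa [compl_compl])
  exact ⟨aᶜ, bᶜ, by rw [Side.coe_compl, Side.coe_compl, ← compl_sup, hab, compl_compl]⟩

theorem nonempty_side (h : HasFivePoints B) : Nonempty (Side B) :=
  let ⟨a, _⟩ := h.exists_sides_inf_eq (x := ⊥) fun hbot => hbot.1 rfl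
  ⟨a⟩

theorem exists_finset_sup_inf_eq (h : HasFivePoints B) (x : B) :
    ∃ F : Finset (Side B × Side B), F.sup (fun p => (p.1 ⊓ p.2 : B)) = x := by
  classical
  by_cases hx : IsThick x
  · by_cases hxc : IsThick xᶜ
    · exact ⟨{(⟨x, hx, hxc⟩, ⟨x, hx, hxc⟩)}, by simp⟩
    · obtain ⟨a, b, rfl⟩ := h.exists_sides_sup_eq hxc
      exact ⟨{(a, a), (b, b)}, by simp⟩
  · obtain ⟨a, b, rfl⟩ := h.exists_sides_inf_eq hx
    exact ⟨{(a, b)}, by simp⟩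

theorem exists_side_lt (h : HasFivePoints B) (a : Side B) : ∃ b, b < a ∨ b < aᶜ := by
  obtain ⟨p, hp, hpa⟩ := isThick_iff_exists_lt.1 a.2.1
  obtain ⟨q, hq, hqa⟩ := isThick_iff_exists_lt.1 a.2.2
  have hcover : p ⊔ a \ p ⊔ q ⊔ (a : B)ᶜ \ q = ⊤ := by
    rw [sup_sdiff_cancel_right hpa.le, sup_assoc, sup_sdiff_cancel_right hqa.le, sup_compl_eq_top]
  have hside (b : Side B) {y : B} (hy : IsThick y) (hyb : y < b) : ∃ c, c < b :=
    ⟨⟨y, hy, b.isThick_compl_of_le hyb.le⟩, hyb⟩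
  rcases h _ _ _ _ hcover with hthick | hthick | hthick | hthick
  · exact (hside a hthick hpa).imp fun _ => Or.inl
  · exact (hside a hthick (sdiff_lt hpa.le hp)).imp fun _ => Or.inl
  · exact (hside aᶜ hthick hqa).imp fun _ => Or.inr
  · exact (hside aᶜ hthick (sdiff_lt hqa.le hq)).imp fun _ => Or.inr

end HasFivePoints

namespace Side

variable {a b c d m : Side B}

theorem map_inf_eq_iff (Ψ : Side B ≃o Side C) :
    (Ψ a ⊓ Ψ b : C) = Ψ m ↔ (a ⊓ b : B) = m := by
  rw [← isGLB_pair_iff, ← isGLB_pair_iff, ← Set.image_pair, Ψ.isGLB_image']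

theorem map_sup_eq_iff (Ψ : Side B ≃o Side C) :
    (Ψ a ⊔ Ψ b : C) = Ψ m ↔ (a ⊔ b : B) = m := by
  rw [← isLUB_pair_iff, ← isLUB_pair_iff, ← Set.image_pair, Ψ.isLUB_image']

theorem isThick_map_inf (Ψ : Side B ≃o Side C) (h : IsThick (a ⊓ b : B)) :
    IsThick (Ψ a ⊓ Ψ b : C) := by
  let m : Side B := ⟨a ⊓ b, h, a.isThick_compl_of_le inf_le_left⟩
  rw [(map_inf_eq_iff Ψ (m := m)).2 rfl]
  exact (Ψ m).2.1

theorem isThick_map_inf_iff (Ψ : Side B ≃o Side C) :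
    IsThick (Ψ a ⊓ Ψ b : C) ↔ IsThick (a ⊓ b : B) :=
  ⟨fun h => by simpa using isThick_map_inf Ψ.symm h, isThick_map_inf Ψ⟩

/-- The witnesses `x`, `y`, `z` consist of two of the three points `a ⊓ b`, `a ⊓ c`, `b ⊓ c` each,
and `w` of all three; five points make `w` a side. -/
theorem exists_sides_of_isAtom_inf (h : HasFivePoints B) (hab : IsAtom (a ⊓ b : B))
    (hac : IsAtom (a ⊓ c : B)) (hbc : IsAtom (b ⊓ c : B)) (habc : Disjoint (a ⊓ b : B) c) :
    ∃ x y z w : Side B, x ≤ a ∧ y ≤ b ∧ z ≤ c ∧ z ≤ w ∧ (x ⊔ y : B) = w := by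
  have hab_ac : Disjoint (a ⊓ b : B) (a ⊓ c) := habc.mono_right inf_le_right
  have hab_bc : Disjoint (a ⊓ b : B) (b ⊓ c) := habc.mono_right inf_le_right
  have hac_bc : Disjoint (a ⊓ c : B) (b ⊓ c) := by
    rw [disjoint_iff, ← inf_inf_distrib_right, ← disjoint_iff]
    exact habc
  have hcompl : IsThick ((a ⊓ b ⊔ a ⊓ c ⊔ b ⊓ c : B)ᶜ) := by
    rcases h (a ⊓ b) (a ⊓ c) (b ⊓ c) _ sup_compl_eq_top with hthick | hthick | hthick | hthick
    · exact absurd hab hthick.2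
    · exact absurd hac hthick.2
    · exact absurd hbc hthick.2
    · exact hthick
  have hx : (a ⊓ b ⊔ a ⊓ c : B) ≤ a := sup_le inf_le_left inf_le_left
  have hy : (a ⊓ b ⊔ b ⊓ c : B) ≤ b := sup_le inf_le_right inf_le_left
  have hz : (a ⊓ c ⊔ b ⊓ c : B) ≤ c := sup_le inf_le_right inf_le_right
  have hxthick := isThick_sup_of_disjoint hab.1 hac.1 hab_ac
  exact ⟨⟨_, hxthick, isThick_compl_of_le a hx⟩,
    ⟨_, isThick_sup_of_disjoint hab.1 hbc.1 hab_bc, isThick_compl_of_le b hy⟩,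
    ⟨_, isThick_sup_of_disjoint hac.1 hbc.1 hac_bc, isThick_compl_of_le c hz⟩,
    ⟨_, hxthick.mono le_sup_left, hcompl⟩, hx, hy, hz,
    sup_le (le_sup_right.trans le_sup_left) le_sup_right,
    (sup_sup_distrib_left _ _ _).symm.trans (sup_assoc _ _ _).symm⟩

variable {Ψ : Side B ≃o Side C}

theorem disjoint_map_iff (hΨ : ∀ a, Ψ aᶜ = (Ψ a)ᶜ) :
    Disjoint (Ψ a : C) (Ψ b) ↔ Disjoint (a : B) b := by
  rw [← le_compl_iff_disjoint, ← le_compl_iff_disjoint, ← hΨ, Ψ.le_iff_le]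

theorem isAtom_inf_of_not_disjoint_map_inf (hΨ : ∀ a, Ψ aᶜ = (Ψ a)ᶜ)
    (h : Disjoint (a ⊓ b : B) c) (hmap : ¬ Disjoint (Ψ a ⊓ Ψ b : C) (Ψ c)) :
    IsAtom (a ⊓ b : B) ∧ IsAtom (Ψ a ⊓ Ψ b : C) := by
  have hthick : ¬ IsThick (a ⊓ b : B) := by
    intro hthick
    let m : Side B := ⟨a ⊓ b, hthick, a.isThick_compl_of_le inf_le_left⟩
    rw [(map_inf_eq_iff Ψ (m := m)).2 rfl, disjoint_map_iff hΨ] at hmap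
    exact hmap h
  have hbot : ¬ Disjoint (Ψ a : C) (Ψ b) := fun hdisj =>
    hmap (by rw [hdisj.eq_bot]; exact disjoint_bot_left)
  exact ⟨isAtom_of_not_isThick (by rwa [disjoint_map_iff hΨ, disjoint_iff] at hbot) hthick,
    isAtom_of_not_isThick (by rwa [disjoint_iff] at hbot) (by rwa [isThick_map_inf_iff])⟩

theorem disjoint_map_inf (h5 : HasFivePoints B) (hΨ : ∀ a, Ψ aᶜ = (Ψ a)ᶜ)
    (h : Disjoint (a ⊓ b : B) c) : Disjoint (Ψ a ⊓ Ψ b : C) (Ψ c) := by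
  by_contra hmap
  obtain ⟨hab, hab'⟩ := isAtom_inf_of_not_disjoint_map_inf hΨ h hmap
  obtain ⟨hac, hac'⟩ := isAtom_inf_of_not_disjoint_map_inf hΨ (a := a) (b := c) (c := b)
    (by rwa [disjoint_iff, inf_right_comm, ← disjoint_iff])
    (by rwa [disjoint_iff, inf_right_comm, ← disjoint_iff])
  obtain ⟨hbc, hbc'⟩ := isAtom_inf_of_not_disjoint_map_inf hΨ (a := b) (b := c) (c := a)
    (by rwa [disjoint_comm, ← disjoint_assoc]) (by rwa [disjoint_comm, ← disjoint_assoc])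
  obtain ⟨x, y, z, w, hxa, hyb, hzc, hzw, hw⟩ := exists_sides_of_isAtom_inf h5 hab hac hbc h
  have hac_le : (Ψ a ⊓ Ψ c : C) ≤ Ψ b :=
    hac'.not_disjoint_iff_le.1 (by rwa [disjoint_iff, inf_right_comm, ← disjoint_iff])
  have hbc_le : (Ψ b ⊓ Ψ c : C) ≤ Ψ a :=
    hbc'.not_disjoint_iff_le.1 (by rwa [disjoint_comm, ← disjoint_assoc])
  have hzw' : (Ψ z : C) ≤ (Ψ x ⊔ Ψ y : C) :=
    (map_sup_eq_iff Ψ).2 hw ▸ Subtype.coe_le_coe.2 (Ψ.monotone hzw)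
  have hz : (Ψ z : C) ≤ (Ψ a ⊓ Ψ b : C) := by
    calc (Ψ z : C)
      _ ≤ ((Ψ x ⊔ Ψ y) ⊓ Ψ c : C) :=
        le_inf hzw' (Ψ.monotone hzc)
      _ ≤ ((Ψ a ⊔ Ψ b) ⊓ Ψ c : C) :=
        inf_le_inf_right _ (sup_le_sup (Ψ.monotone hxa) (Ψ.monotone hyb))
      _ = (Ψ a ⊓ Ψ c ⊔ Ψ b ⊓ Ψ c : C) := inf_sup_right ..
      _ ≤ (Ψ a ⊓ Ψ b : C) :=
        sup_le (le_inf inf_le_left hac_le) (le_inf hbc_le inf_le_left)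
  exact ((Ψ z).2.1.mono hz).2 hab'

theorem disjoint_map_inf_inf (h5 : HasFivePoints B) (hΨ : ∀ a, Ψ aᶜ = (Ψ a)ᶜ)
    (h : Disjoint (a ⊓ b : B) (c ⊓ d)) : Disjoint (Ψ a ⊓ Ψ b : C) (Ψ c ⊓ Ψ d) := by
  by_cases hthick : IsThick (a ⊓ b : B)
  · let m : Side B := ⟨a ⊓ b, hthick, a.isThick_compl_of_le inf_le_left⟩
    rw [(map_inf_eq_iff Ψ (m := m)).2 rfl]
    exact (disjoint_map_inf h5 hΨ h.symm).symm
  by_cases hab : Disjoint (a : B) b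
  · rw [((disjoint_map_iff hΨ).2 hab).eq_bot]
    exact disjoint_bot_left
  have hatom : IsAtom (a ⊓ b : B) := isAtom_of_not_isThick (mt disjoint_iff.2 hab) hthick
  rw [← hatom.not_le_iff_disjoint, le_inf_iff, not_and_or, hatom.not_le_iff_disjoint,
    hatom.not_le_iff_disjoint] at h
  rcases h with h | h
  · exact (disjoint_map_inf h5 hΨ h).mono_right inf_le_left
  · exact (disjoint_map_inf h5 hΨ h).mono_right inf_le_right

theorem map_compl_symm (hΨ : ∀ a, Ψ aᶜ = (Ψ a)ᶜ) (a : Side C) : Ψ.symm aᶜ = (Ψ.symm a)ᶜ := by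
  rw [Ψ.symm_apply_eq, hΨ, Ψ.apply_symm_apply]

theorem exists_orderIso_extending (hB : HasFivePoints B) (hC : HasFivePoints C)
    (hΨ : ∀ a, Ψ aᶜ = (Ψ a)ᶜ) : ∃ φ : B ≃o C, ∀ a : Side B, φ a = Ψ a := by
  have hcover (y : C) :
      ∃ F : Finset (Side B × Side B), F.sup (fun p => (Ψ p.1 ⊓ Ψ p.2 : C)) = y := by
    obtain ⟨F, rfl⟩ := hC.exists_finset_sup_inf_eq y
    refine ⟨F.map (Ψ.symm.toEquiv.prodCongr Ψ.symm.toEquiv).toEmbedding, ?_⟩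
    simp [Finset.sup_map, Function.comp_def]
  obtain ⟨φ, hφ⟩ := exists_orderIso_of_disjoint_iff hB.exists_finset_sup_inf_eq hcover
    fun p q => ⟨disjoint_map_inf_inf hB hΨ, fun h => by
      simpa using disjoint_map_inf_inf hC (map_compl_symm hΨ) h⟩
  exact ⟨φ, fun a => by simpa using hφ (a, a)⟩

end Side

end Sides

section Cuts

variable {B C : Type*} [BooleanAlgebra B] [BooleanAlgebra C]

namespace Side

variable {a b c x : Side B}

theorem compl_le_compl_iff : aᶜ ≤ bᶜ ↔ b ≤ a :=
  _root_.compl_le_compl_iff_le (x := (b : B)) (y := (a : B))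

theorem compl_lt_compl_iff : aᶜ < bᶜ ↔ b < a :=
  lt_iff_lt_of_le_iff_le' compl_le_compl_iff compl_le_compl_iff

theorem not_le_compl_of_le (hca : c ≤ a) (hcb : c ≤ b) : ¬ a ≤ bᶜ := fun hab =>
  c.2.1.1 (le_bot_iff.1 (le_compl_iff_disjoint.1 hab hca hcb))

theorem not_compl_le_of_le (hac : a ≤ c) (hbc : b ≤ c) : ¬ aᶜ ≤ b := fun hab =>
  not_le_compl_of_le (compl_le_compl_iff.2 hac) (compl_le_compl_iff.2 hbc)
    (hab.trans_eq (compl_compl b).symm)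

/-- The non-peripheral cut with a given side. -/
def cut (a : Side B) : CutVertex B :=
  ⟨s((a : B), (a : B)ᶜ), ⟨a, rfl⟩, fun _ hx => by
    rcases Sym2.mem_iff.1 hx with rfl | rfl
    exacts [a.2.1, a.2.2]⟩

theorem cut_compl (a : Side B) : aᶜ.cut = a.cut :=
  Subtype.ext <| by
    change s((a : B)ᶜ, (a : B)ᶜᶜ) = s((a : B), (a : B)ᶜ)
    rw [_root_.compl_compl, Sym2.eq_swap]

theorem cut_surjective : Function.Surjective (cut : Side B → CutVertex B) := by
  rintro ⟨v, ⟨a, rfl⟩, hv⟩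
  exact ⟨⟨a, hv a (Sym2.mem_mk_left _ _), hv _ (Sym2.mem_mk_right _ _)⟩, rfl⟩

theorem cut_eq_iff : a.cut = b.cut ↔ a = b ∨ a = bᶜ := by
  constructor
  · intro h
    have hmem : (a : B) ∈ b.cut.1 := h ▸ Sym2.mem_mk_left _ _
    exact (Sym2.mem_iff.1 hmem).imp Subtype.ext Subtype.ext
  · rintro (rfl | rfl)
    exacts [rfl, cut_compl b]

theorem crosses_cut_iff :
    Crosses a.cut.1 b.cut.1 ↔ ¬ a ≤ b ∧ ¬ a ≤ bᶜ ∧ ¬ aᶜ ≤ b ∧ ¬ aᶜ ≤ bᶜ := by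
  have hle (c d : Side B) : c ≤ d ↔ (c ⊓ (d : B)ᶜ : B) = ⊥ := by
    rw [← Subtype.coe_le_coe, ← sdiff_eq, sdiff_eq_bot_iff]
  rw [hle, hle, hle, hle]
  change (∀ x ∈ s((a : B), (a : B)ᶜ), ∀ y ∈ s((b : B), (b : B)ᶜ), x ⊓ y ≠ ⊥) ↔ _
  simp only [Sym2.mem_iff, forall_eq_or_imp, forall_eq, coe_compl, _root_.compl_compl]
  tauto

theorem lt_iff_le_and_cut_ne : a < b ↔ a ≤ b ∧ a.cut ≠ b.cut := by
  rw [lt_iff_le_and_ne, ne_eq, ne_eq, cut_eq_iff, not_or]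
  refine and_congr_right fun hab => (and_iff_left ?_).symm
  rintro rfl
  exact not_compl_le_of_le le_rfl le_rfl hab

/-- The half of the link of `b.cut` formed by the cuts that have a side strictly inside `b`. -/
def inside (b : Side B) : Set (CutVertex B) := cut '' Set.Iio b

theorem cut_mem_inside_iff : a.cut ∈ b.inside ↔ a < b ∨ aᶜ < b := by
  constructor
  · rintro ⟨c, hcb, hca⟩
    rcases cut_eq_iff.1 hca with rfl | rfl
    exacts [Or.inl hcb, Or.inr hcb]
  · rintro (h | h)
    exacts [⟨a, h, rfl⟩, ⟨aᶜ, h, cut_compl a⟩]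

theorem adj_cut_iff {v : CutVertex B} :
    (cutComplex B).Adj v a.cut ↔ v ∈ a.inside ∨ v ∈ aᶜ.inside := by
  obtain ⟨b, rfl⟩ := cut_surjective v
  change b.cut ≠ a.cut ∧ ¬ Crosses b.cut.1 a.cut.1 ↔ _
  simp only [crosses_cut_iff, cut_mem_inside_iff, lt_iff_le_and_cut_ne, cut_compl]
  tauto

theorem not_crosses_of_mem_inside {u v : CutVertex B} (hu : u ∈ a.inside) (hv : v ∈ aᶜ.inside) :
    ¬ Crosses u.1 v.1 := by
  obtain ⟨b, hb, rfl⟩ := hu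
  obtain ⟨c, hc, rfl⟩ := hv
  have hbc : b ≤ cᶜ := hb.le.trans ((compl_compl a).ge.trans (compl_le_compl_iff.2 hc.le))
  exact fun h => (crosses_cut_iff.1 h).2.1 hbc

theorem disjoint_inside_compl (a : Side B) : Disjoint a.inside aᶜ.inside := by
  rw [Set.disjoint_left]
  rintro _ ⟨b, hb, rfl⟩ hb'
  rcases cut_mem_inside_iff.1 hb' with h | h
  · exact not_le_compl_of_le le_rfl hb.le h.le
  · exact (compl_lt_compl_iff.1 h).not_gt hb

theorem mem_inside_compl_iff {v : CutVertex B} :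
    v ∈ aᶜ.inside ↔ (cutComplex B).Adj v a.cut ∧ v ∉ a.inside := by
  have hdisj : v ∈ aᶜ.inside → v ∉ a.inside := fun hv =>
    Set.disjoint_right.1 (disjoint_inside_compl a) hv
  rw [adj_cut_iff]
  tauto

theorem lt_iff_cut_mem_inside : a < b ↔ a.cut ∈ b.inside ∧ b.cut ∈ aᶜ.inside := by
  rw [cut_mem_inside_iff, cut_mem_inside_iff, compl_lt_compl_iff]
  constructor
  · exact fun h => ⟨Or.inl h, Or.inr h⟩
  · rintro ⟨h | h, h' | h'⟩
    exacts [h, h, absurd h h'.not_gt, h']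

theorem exists_adj_cut (h : HasFivePoints B) (a : Side B) : ∃ u, (cutComplex B).Adj u a.cut := by
  obtain ⟨b, hb⟩ := h.exists_side_lt a
  exact ⟨b.cut, adj_cut_iff.2 (hb.imp (fun h => ⟨b, h, rfl⟩) fun h => ⟨b, h, rfl⟩)⟩

theorem crosses_cut_of_eq_sup {p r : B} (hxa : x ≤ a) (hba : b ≤ a) (hx : (x : B) = p ⊔ r)
    (hp : p ≠ ⊥) (hr : r ≠ ⊥) (hpb : p < b) (hrb : Disjoint r b) : Crosses x.cut.1 b.cut.1 := by
  have hpx : p ≤ x := hx ▸ le_sup_left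
  have hrx : r ≤ x := hx ▸ le_sup_right
  refine crosses_cut_iff.2 ⟨fun hxb => ?_, fun hxb => ?_, not_compl_le_of_le hxa hba, fun hxb => ?_⟩
  · exact hr (hrb.eq_bot_of_le (hrx.trans hxb))
  · exact hp (le_bot_iff.1 (le_compl_iff_disjoint.1 hxb hpx hpb.le))
  · have hbx : (b : B) ≤ p ⊔ r := hx ▸ compl_le_compl_iff.1 hxb
    exact hpb.not_ge (Disjoint.left_le_of_le_sup_right hbx hrb.symm)

theorem exists_pair_cutting (hb : b < a) (hc : c < a) :
    ∃ p r : B, p ≠ ⊥ ∧ r ≠ ⊥ ∧ r ≤ a ∧ p < b ∧ Disjoint r b ∧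
      (p < c ∧ Disjoint r c ∨ r < c ∧ Disjoint p c) := by
  have hdiff {d e : Side B} (h : ¬ d ≤ e) : (d \ e : B) ≠ ⊥ := mt sdiff_eq_bot_iff.1 h
  by_cases hbc : b ≤ c
  · obtain ⟨p, hp, hpb⟩ := isThick_iff_exists_lt.1 b.2.1
    have hdisj : Disjoint (a \ c : B) c := disjoint_sdiff_self_left
    exact ⟨p, a \ c, hp, hdiff hc.not_ge, sdiff_le, hpb, hdisj.mono_right hbc,
      Or.inl ⟨hpb.trans_le hbc, hdisj⟩⟩
  by_cases hcb : c ≤ b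
  · obtain ⟨p, hp, hpc⟩ := isThick_iff_exists_lt.1 c.2.1
    have hdisj : Disjoint (a \ b : B) b := disjoint_sdiff_self_left
    exact ⟨p, a \ b, hp, hdiff hb.not_ge, sdiff_le, hpc.trans_le hcb, hdisj,
      Or.inl ⟨hpc, hdisj.mono_right hcb⟩⟩
  obtain ⟨p, hp, hple, hpb⟩ := b.2.1.exists_lt_of_le (hdiff hbc) sdiff_le
  obtain ⟨r, hr, hrle, hrc⟩ := c.2.1.exists_lt_of_le (hdiff hcb) sdiff_le
  exact ⟨p, r, hp, hr, hrc.le.trans hc.le, hpb, disjoint_sdiff_self_left.mono_left hrle,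
    Or.inr ⟨hrc, disjoint_sdiff_self_left.mono_left hple⟩⟩

theorem exists_lt_crosses (hb : b < a) (hc : c < a) :
    ∃ x < a, Crosses x.cut.1 b.cut.1 ∧ Crosses x.cut.1 c.cut.1 := by
  obtain ⟨p, r, hp, hr, hra, hpb, hrb, hpr⟩ := exists_pair_cutting hb hc
  have hle : p ⊔ r ≤ a := sup_le (hpb.le.trans hb.le) hra
  have hdisj : Disjoint p r := (hrb.mono_right hpb.le).symm
  let x : Side B := ⟨p ⊔ r, isThick_sup_of_disjoint hp hr hdisj, a.isThick_compl_of_le hle⟩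
  have hxa : x ≤ a := hle
  have hxb : Crosses x.cut.1 b.cut.1 := crosses_cut_of_eq_sup hxa hb.le rfl hp hr hpb hrb
  refine ⟨x, lt_of_le_of_ne hxa ?_, hxb, ?_⟩
  · intro h
    exact (crosses_cut_iff.1 hxb).2.2.2 (compl_le_compl_iff.2 (h ▸ hb.le))
  · rcases hpr with ⟨hpc, hrc⟩ | ⟨hrc, hpc⟩
    · exact crosses_cut_of_eq_sup hxa hc.le rfl hp hr hpc hrc
    · exact crosses_cut_of_eq_sup hxa hc.le (sup_comm p r) hr hp hrc hpc

end Side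

theorem crosses_comm {s t : Sym2 B} : Crosses s t ↔ Crosses t s := by
  have hswap {s t : Sym2 B} (h : Crosses s t) : Crosses t s := fun a ha b hb => by
    rw [inf_comm]
    exact h b hb a ha
  exact ⟨hswap, hswap⟩

theorem compl_cutComplex_adj_iff {u v : CutVertex B} :
    (cutComplex B)ᶜ.Adj u v ↔ Crosses u.1 v.1 := by
  rw [SimpleGraph.compl_adj]
  constructor
  · exact fun h => of_not_not fun hc => h.2 ⟨h.1, hc⟩
  · refine fun h => ⟨?_, fun hadj => hadj.2 h⟩
    rintro rfl
    obtain ⟨a, rfl⟩ := Side.cut_surjective u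
    exact (Side.crosses_cut_iff.1 h).1 le_rfl

/-- Some vertex of the link of `w` is adjacent to neither `u` nor `v`. In the complex of cuts this
says that `u` and `v`, taken in the link of `w`, lie on the same side of the cut `w`. -/
def SameSide {V : Type*} (G : SimpleGraph V) (w u v : V) : Prop :=
  ∃ x, G.Adj x w ∧ Gᶜ.Adj x u ∧ Gᶜ.Adj x v

theorem sameSide_map_iff {V W : Type*} {G : SimpleGraph V} {H : SimpleGraph W} (ψ : G ≃g H)
    {w u v : V} : SameSide H (ψ w) (ψ u) (ψ v) ↔ SameSide G w u v := by
  simp only [SameSide, ψ.surjective.exists, SimpleGraph.compl_adj, ψ.map_adj_iff,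
    ψ.injective.ne_iff]

namespace Side

variable {a b : Side B}

theorem sameSide_of_mem_inside {u v : CutVertex B} (hu : u ∈ a.inside) (hv : v ∈ a.inside) :
    SameSide (cutComplex B) a.cut u v := by
  obtain ⟨b, hb, rfl⟩ := hu
  obtain ⟨c, hc, rfl⟩ := hv
  obtain ⟨x, hx, hxb, hxc⟩ := exists_lt_crosses hb hc
  exact ⟨x.cut, adj_cut_iff.2 (Or.inl ⟨x, hx, rfl⟩), compl_cutComplex_adj_iff.2 hxb,
    compl_cutComplex_adj_iff.2 hxc⟩

theorem mem_inside_iff_of_crosses {u v : CutVertex B} (hu : (cutComplex B).Adj u a.cut)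
    (hv : (cutComplex B).Adj v a.cut) (h : Crosses u.1 v.1) : u ∈ a.inside ↔ v ∈ a.inside := by
  rw [adj_cut_iff] at hu hv
  have huv := fun hu hv => not_crosses_of_mem_inside (a := a) hu hv h
  have hvu := fun hv hu => not_crosses_of_mem_inside (a := a) hv hu (crosses_comm.1 h)
  tauto

theorem sameSide_iff {u v : CutVertex B} (hu : (cutComplex B).Adj u a.cut)
    (hv : (cutComplex B).Adj v a.cut) :
    SameSide (cutComplex B) a.cut u v ↔ (u ∈ a.inside ↔ v ∈ a.inside) := by
  constructor
  · rintro ⟨x, hx, hxu, hxv⟩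
    rw [compl_cutComplex_adj_iff] at hxu hxv
    rw [← mem_inside_iff_of_crosses hx hu hxu, mem_inside_iff_of_crosses hx hv hxv]
  · intro h
    by_cases hua : u ∈ a.inside
    · exact sameSide_of_mem_inside hua (h.1 hua)
    · rw [← cut_compl]
      exact sameSide_of_mem_inside (mem_inside_compl_iff.2 ⟨hu, hua⟩)
        (mem_inside_compl_iff.2 ⟨hv, mt h.2 hua⟩)

end Side

/-- The side `a'` corresponds to the side `a` under the isomorphism `ψ` of complexes of cuts: it is
a side of the cut `ψ a.cut`, namely the one for which `ψ` matches the half-links. -/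
structure IsImage (ψ : cutComplex B ≃g cutComplex C) (a : Side B) (a' : Side C) : Prop where
  cut_eq : a'.cut = ψ a.cut
  mem_inside_iff : ∀ u, ψ u ∈ a'.inside ↔ u ∈ a.inside

namespace IsImage

variable {ψ : cutComplex B ≃g cutComplex C} {a b : Side B} {a' b' : Side C}

theorem symm (h : IsImage ψ a a') : IsImage ψ.symm a' a where
  cut_eq := by rw [h.cut_eq]; exact (ψ.symm_apply_apply _).symm
  mem_inside_iff u := by
    rw [← h.mem_inside_iff]
    exact iff_of_eq (congrArg (· ∈ a'.inside) (ψ.apply_symm_apply u))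

theorem compl (h : IsImage ψ a a') : IsImage ψ aᶜ a'ᶜ where
  cut_eq := by rw [Side.cut_compl, Side.cut_compl, h.cut_eq]
  mem_inside_iff u := by
    rw [Side.mem_inside_compl_iff, Side.mem_inside_compl_iff, h.cut_eq, ψ.map_adj_iff,
      h.mem_inside_iff]

theorem lt (ha : IsImage ψ a a') (hb : IsImage ψ b b') (h : a < b) : a' < b' := by
  rw [Side.lt_iff_cut_mem_inside] at h ⊢
  rwa [ha.cut_eq, hb.cut_eq, hb.mem_inside_iff, ha.compl.mem_inside_iff]

theorem unique (h5 : HasFivePoints B) (hb : IsImage ψ a a') (hc : IsImage ψ a b') : a' = b' := by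
  refine (Side.cut_eq_iff.1 (hb.cut_eq.trans hc.cut_eq.symm)).resolve_right ?_
  rintro rfl
  obtain ⟨u, hu⟩ := Side.exists_adj_cut h5 a
  have hiff := hb.mem_inside_iff u
  rw [Side.mem_inside_compl_iff, hc.cut_eq, ψ.map_adj_iff, hc.mem_inside_iff] at hiff
  tauto

theorem of_mem_inside_iff {u : CutVertex B} (hcut : a'.cut = ψ a.cut)
    (hu : (cutComplex B).Adj u a.cut) (h : ψ u ∈ a'.inside ↔ u ∈ a.inside) : IsImage ψ a a' := by
  have hadj (v : CutVertex B) : (cutComplex C).Adj (ψ v) a'.cut ↔ (cutComplex B).Adj v a.cut := by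
    rw [hcut, ψ.map_adj_iff]
  refine ⟨hcut, fun v => ?_⟩
  by_cases hv : (cutComplex B).Adj v a.cut
  · have hsame := Side.sameSide_iff hu hv
    rw [← sameSide_map_iff ψ, ← hcut, Side.sameSide_iff ((hadj u).2 hu) ((hadj v).2 hv)] at hsame
    tauto
  · have hv' := mt (hadj v).1 hv
    rw [Side.adj_cut_iff] at hv hv'
    tauto

theorem exists_isImage (h5 : HasFivePoints B) (ψ : cutComplex B ≃g cutComplex C) (a : Side B) :
    ∃ a', IsImage ψ a a' := by
  obtain ⟨u, hu⟩ := Side.exists_adj_cut h5 a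
  obtain ⟨c, hc⟩ := Side.cut_surjective (ψ a.cut)
  by_cases h : ψ u ∈ c.inside ↔ u ∈ a.inside
  · exact ⟨c, of_mem_inside_iff hc hu h⟩
  · refine ⟨cᶜ, of_mem_inside_iff (by rw [Side.cut_compl, hc]) hu ?_⟩
    rw [Side.mem_inside_compl_iff, hc, ψ.map_adj_iff]
    tauto

end IsImage

theorem exists_side_orderIso_cut_eq (hB : HasFivePoints B) (hC : HasFivePoints C)
    (ψ : cutComplex B ≃g cutComplex C) :
    ∃ Ψ : Side B ≃o Side C, (∀ a, Ψ aᶜ = (Ψ a)ᶜ) ∧ ∀ a, (Ψ a).cut = ψ a.cut := by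
  choose f hf using IsImage.exists_isImage hB ψ
  choose g hg using IsImage.exists_isImage hC ψ.symm
  let e : Side B ≃ Side C :=
    { toFun := f
      invFun := g
      left_inv := fun a => (hg (f a)).unique hC (hf a).symm
      right_inv := fun a => (hf (g a)).unique hB (hg a).symm }
  have hlt {a b : Side B} : e a < e b ↔ a < b :=
    ⟨fun h => by simpa [e.left_inv _] using (hf a).symm.lt (hf b).symm h,
      fun h => (hf a).lt (hf b) h⟩
  exact ⟨OrderIso.ofRelIsoLT ⟨e, hlt⟩, fun a => (hf aᶜ).unique hB (hf a).compl,
    fun a => (hf a).cut_eq⟩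

end Cuts

section TopologicalGroups

namespace IsTopGroupIso

variable {G H K : Type*} [Group G] [TopologicalSpace G] [Group H] [TopologicalSpace H]
  [Group K] [TopologicalSpace K]

theorem of_isInducing {f : G →* H} (hf : Function.Bijective f) (h : Topology.IsInducing f) :
    IsTopGroupIso f :=
  ⟨{ (Equiv.ofBijective f hf).toHomeomorphOfIsInducing h with map_mul' := map_mul f }, fun _ => rfl⟩

theorem comp {g : H →* K} {f : G →* H} (hg : IsTopGroupIso g) (hf : IsTopGroupIso f) :
    IsTopGroupIso (g.comp f) := by
  obtain ⟨e, he⟩ := hg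
  obtain ⟨e', he'⟩ := hf
  exact ⟨e'.trans e, fun x => by simp [← he, ← he']⟩

theorem of_comp {g : H →* K} {f : G →* H} (hg : IsTopGroupIso g)
    (h : IsTopGroupIso (g.comp f)) : IsTopGroupIso f := by
  obtain ⟨e, he⟩ := hg
  obtain ⟨e', he'⟩ := h
  refine ⟨e'.trans e.symm, fun x => ?_⟩
  change e.symm (e' x) = f x
  rw [he', MonoidHom.comp_apply, ← he, e.symm_apply_apply]

end IsTopGroupIso

theorem isInducing_of_forall_exists_finset {α β : Type*} {r : α → α → Prop} {s : β → β → Prop}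
    (f : (r ≃r r) →* (s ≃r s))
    (hcont : ∀ y, ∃ F : Finset α, ∀ φ : r ≃r r, (∀ x ∈ F, φ x = x) → f φ y = y)
    (hopen : ∀ x, ∃ F : Finset β, ∀ φ : r ≃r r, (∀ y ∈ F, f φ y = y) → φ x = x) :
    Topology.IsInducing f := by
  classical
  rw [IsTopologicalGroup.isInducing_iff_nhds_one]
  ext t
  rw [Filter.mem_comap, mem_nhds_one_iff_stabilizer]
  choose K hK using hcont
  choose L hL using hopen
  constructor
  · rintro ⟨F, hF⟩
    exact ⟨_, (mem_nhds_one_iff_stabilizer _).2 ⟨F.biUnion L, le_rfl⟩, fun φ hφ =>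
      hF fun x hx => hL x φ fun y hy => hφ y (Finset.mem_biUnion.2 ⟨x, hx, hy⟩)⟩
  · rintro ⟨u, hu, hut⟩
    obtain ⟨F, hF⟩ := (mem_nhds_one_iff_stabilizer _).1 hu
    exact ⟨F.biUnion K, fun φ hφ => hut <|
      hF fun y hy => hK y φ fun x hx => hφ x (Finset.mem_biUnion.2 ⟨y, hy, hx⟩)⟩

end TopologicalGroups

section CutAction

variable {B : Type*} [BooleanAlgebra B] {φ : B ≃o B} {a b : Side B}

theorem mapCut_cut (h : φ a = b) : mapCut φ a.cut = b.cut :=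
  Subtype.ext <| by
    change Sym2.map φ s((a : B), (a : B)ᶜ) = s((b : B), (b : B)ᶜ)
    rw [Sym2.map_mk, map_compl, h]

theorem apply_eq_or_eq_compl_of_mapCut_eq (h : mapCut φ a.cut = a.cut) :
    φ a = a ∨ φ a = (a : B)ᶜ := by
  let b : Side B := ⟨φ a, (isThick_map_iff φ).2 a.2.1, by
    rw [← map_compl, isThick_map_iff]
    exact a.2.2⟩
  have hb : b.cut = a.cut := (mapCut_cut rfl).symm.trans h
  exact (Side.cut_eq_iff.1 hb).imp (congrArg Subtype.val) (congrArg Subtype.val)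

theorem apply_eq_of_mapCut_eq (hab : b < a) (ha : mapCut φ a.cut = a.cut)
    (hb : mapCut φ b.cut = b.cut) : φ a = a := by
  refine (apply_eq_or_eq_compl_of_mapCut_eq ha).resolve_right fun hφa => ?_
  have hle : φ b ≤ (a : B)ᶜ := hφa ▸ φ.monotone hab.le
  rcases apply_eq_or_eq_compl_of_mapCut_eq hb with hφb | hφb <;> rw [hφb] at hle
  · exact Side.not_le_compl_of_le (a := b) (b := a) le_rfl hab.le hle
  · exact hab.not_ge (Side.compl_le_compl_iff.1 hle)

namespace HasFivePoints

theorem exists_finset_side_fixed (h : HasFivePoints B) (a : Side B) :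
    ∃ F : Finset (CutVertex B), ∀ φ : B ≃o B, (∀ v ∈ F, mapCut φ v = v) → φ a = a := by
  classical
  obtain ⟨b, hb⟩ := h.exists_side_lt a
  refine ⟨{a.cut, b.cut}, fun φ hφ => ?_⟩
  have ha : mapCut φ a.cut = a.cut := hφ _ (by simp)
  have hb' : mapCut φ b.cut = b.cut := hφ _ (by simp)
  rcases hb with hb | hb
  · exact apply_eq_of_mapCut_eq hb ha hb'
  · have hcompl : φ (a : B)ᶜ = (a : B)ᶜ :=
      apply_eq_of_mapCut_eq hb (by rwa [Side.cut_compl]) hb'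
    rwa [map_compl, compl_inj_iff] at hcompl

theorem exists_finset_fixed (h : HasFivePoints B) (x : B) :
    ∃ F : Finset (CutVertex B), ∀ φ : B ≃o B, (∀ v ∈ F, mapCut φ v = v) → φ x = x := by
  classical
  obtain ⟨P, rfl⟩ := h.exists_finset_sup_inf_eq x
  choose F hF using h.exists_finset_side_fixed
  refine ⟨P.biUnion fun p => F p.1 ∪ F p.2, fun φ hφ => ?_⟩
  rw [map_finset_sup]
  refine Finset.sup_congr rfl fun p hp => ?_
  have hfix {v} (hv : v ∈ F p.1 ∪ F p.2) : mapCut φ v = v :=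
    hφ v (Finset.mem_biUnion.2 ⟨p, hp, hv⟩)
  rw [Function.comp_apply, map_inf, hF p.1 φ fun v hv => hfix (Finset.mem_union_left _ hv),
    hF p.2 φ fun v hv => hfix (Finset.mem_union_right _ hv)]

theorem autCutAction_injective (h : HasFivePoints B) : Function.Injective (autCutAction B) := by
  rw [injective_iff_map_eq_one]
  intro φ hφ
  refine RelIso.ext fun x => ?_
  obtain ⟨F, hF⟩ := h.exists_finset_fixed x
  exact hF φ fun v _ => DFunLike.congr_fun hφ v

theorem autCutAction_surjective (h : HasFivePoints B) : Function.Surjective (autCutAction B) := by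
  intro ψ
  obtain ⟨Ψ, hcompl, hcut⟩ := exists_side_orderIso_cut_eq h h ψ
  obtain ⟨φ, hφ⟩ := Side.exists_orderIso_extending h h hcompl
  refine ⟨φ, RelIso.ext fun v => ?_⟩
  obtain ⟨a, rfl⟩ := Side.cut_surjective v
  exact (mapCut_cut (hφ a)).trans (hcut a)

theorem isInducing_autCutAction (h : HasFivePoints B) : Topology.IsInducing (autCutAction B) := by
  refine isInducing_of_forall_exists_finset _ (fun v => ?_) h.exists_finset_fixed
  obtain ⟨a, rfl⟩ := Side.cut_surjective v
  exact ⟨{(a : B)}, fun φ hφ => mapCut_cut (hφ a (Finset.mem_singleton_self _))⟩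

theorem isTopGroupIso_autCutAction (h : HasFivePoints B) : IsTopGroupIso (autCutAction B) :=
  .of_isInducing ⟨h.autCutAction_injective, h.autCutAction_surjective⟩ h.isInducing_autCutAction

end HasFivePoints

end CutAction

section StoneDuality

namespace StoneSpace

open Order

variable {B : Type*} [BooleanAlgebra B] {a b : B}

theorem coe_ne_univ_iff {F : PFilter B} : (F : Set B) ≠ Set.univ ↔ ⊥ ∉ F := by
  rw [not_iff_comm, not_not, Set.eq_univ_iff_forall]
  exact ⟨fun h b => PFilter.mem_of_le bot_le h, fun h => h ⊥⟩

theorem maximal_of_mem_or_compl_mem {F : PFilter B} (hbot : ⊥ ∉ F) (h : ∀ a, a ∈ F ∨ aᶜ ∈ F) :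
    Maximal (fun F : PFilter B => (F : Set B) ≠ Set.univ) F := by
  refine ⟨coe_ne_univ_iff.2 hbot, fun G hG hFG a ha => (h a).resolve_right fun hac => ?_⟩
  have hinf := PFilter.inf_mem ha (hFG hac)
  rw [inf_compl_eq_bot] at hinf
  exact coe_ne_univ_iff.1 hG hinf

theorem exists_le_forall_mem_or_compl_mem {F : PFilter B} (h : ⊥ ∉ F) :
    ∃ G : PFilter B, F ≤ G ∧ ⊥ ∉ G ∧ ∀ a, a ∈ G ∨ aᶜ ∈ G := by
  have hdisj : Disjoint (F : Set B) (Ideal.principal (⊥ : B)) := by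
    rw [Set.disjoint_left]
    intro x hxF hx
    exact h (le_bot_iff.1 (Ideal.mem_principal.1 hx) ▸ hxF)
  obtain ⟨J, hJ, -, hFJ⟩ := DistribLattice.prime_ideal_of_disjoint_filter_ideal hdisj
  have hmem (a : B) : a ∈ hJ.toPrimePair.F ↔ a ∉ J := Iff.rfl
  refine ⟨hJ.toPrimePair.F, fun a ha => Set.disjoint_left.1 hFJ ha, ?_, fun a => ?_⟩
  · exact fun hbot => (hmem ⊥).1 hbot J.bot_mem
  · rw [hmem, hmem, ← not_and_or]
    rintro ⟨ha, hac⟩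
    have hsup := Ideal.sup_mem ha hac
    rw [sup_compl_eq_top] at hsup
    exact hJ.toIsProper.top_notMem hsup

theorem bot_notMem (ω : StoneSpace B) : ⊥ ∉ ω.1 := coe_ne_univ_iff.1 ω.2.1

theorem compl_mem_iff (ω : StoneSpace B) : aᶜ ∈ ω.1 ↔ a ∉ ω.1 := by
  constructor
  · intro hac ha
    have hinf := PFilter.inf_mem ha hac
    rw [inf_compl_eq_bot] at hinf
    exact ω.bot_notMem hinf
  · obtain ⟨G, hωG, hbot, hG⟩ := exists_le_forall_mem_or_compl_mem ω.bot_notMem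
    have hGω : G ≤ ω.1 := ω.2.2 (coe_ne_univ_iff.2 hbot) hωG
    exact fun ha => hGω ((hG a).resolve_left fun haG => ha (hGω haG))

theorem sup_mem_iff (ω : StoneSpace B) : a ⊔ b ∈ ω.1 ↔ a ∈ ω.1 ∨ b ∈ ω.1 := by
  rw [← not_iff_not, not_or, ← compl_mem_iff, ← compl_mem_iff, ← compl_mem_iff, compl_sup,
    PFilter.inf_mem_iff]

theorem finset_sup_mem_iff (ω : StoneSpace B) {ι : Type*} {F : Finset ι} {f : ι → B} :
    F.sup f ∈ ω.1 ↔ ∃ i ∈ F, f i ∈ ω.1 := by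
  classical
  induction F using Finset.induction_on with
  | empty => simpa using ω.bot_notMem
  | insert i F _ ih => rw [Finset.sup_insert, sup_mem_iff, ih, Finset.exists_mem_insert]

theorem exists_mem (ha : a ≠ ⊥) : ∃ ω : StoneSpace B, a ∈ ω.1 := by
  obtain ⟨G, hG, hbot, hmem⟩ := exists_le_forall_mem_or_compl_mem (F := PFilter.principal a)
    fun h => ha (le_bot_iff.1 (PFilter.mem_principal.1 h))
  exact ⟨⟨G, maximal_of_mem_or_compl_mem hbot hmem⟩, hG (PFilter.mem_principal.2 le_rfl)⟩

/-- The basic open set `U_b` of the ultrafilters that contain `b`. -/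
def basicSet (b : B) : Set (StoneSpace B) := {ω | b ∈ ω.1}

theorem isOpen_basicSet (b : B) : IsOpen (basicSet b) :=
  isOpen_generateFrom_of_mem ⟨b, rfl⟩

theorem compl_basicSet (b : B) : (basicSet b)ᶜ = basicSet bᶜ :=
  Set.ext fun ω => ω.compl_mem_iff.symm

theorem basicSet_inf (a b : B) : basicSet (a ⊓ b) = basicSet a ∩ basicSet b :=
  Set.ext fun _ => PFilter.inf_mem_iff

theorem isClopen_basicSet (b : B) : IsClopen (basicSet b) :=
  ⟨isOpen_compl_iff.1 (compl_basicSet b ▸ isOpen_basicSet bᶜ), isOpen_basicSet b⟩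

theorem basicSet_subset_iff : basicSet a ⊆ basicSet b ↔ a ≤ b := by
  refine ⟨fun h => ?_, fun h ω hω => PFilter.mem_of_le h hω⟩
  by_contra hab
  obtain ⟨ω, hω⟩ := exists_mem (a := a \ b) (mt sdiff_eq_bot_iff.1 hab)
  rw [sdiff_eq, PFilter.inf_mem_iff, compl_mem_iff] at hω
  exact hω.2 (h hω.1)

theorem isTopologicalBasis_basicSet :
    IsTopologicalBasis (Set.range (basicSet : B → Set (StoneSpace B))) where
  exists_subset_inter := by
    rintro _ ⟨a, rfl⟩ _ ⟨b, rfl⟩ ω hω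
    exact ⟨_, ⟨a ⊓ b, rfl⟩, by rwa [basicSet_inf], (basicSet_inf a b).le⟩
  sUnion_eq := Set.eq_univ_of_forall fun ω => ⟨_, ⟨⊤, rfl⟩, PFilter.top_mem⟩
  eq_generateFrom := rfl

instance : TotallySeparatedSpace (StoneSpace B) := by
  rw [totallySeparatedSpace_iff_exists_isClopen]
  intro ω ω' hne
  by_contra! h
  have hle : ω.1 ≤ ω'.1 := fun b hb =>
    of_not_not fun hb' => h (basicSet b) (isClopen_basicSet b) hb hb'
  exact hne (Subtype.ext (hle.antisymm (ω.2.2 ω'.2.1 hle)))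

theorem isPFilter_setOf_basicSet_mem (𝓕 : Filter (StoneSpace B)) :
    IsPFilter {b : B | basicSet b ∈ 𝓕} := by
  refine IsPFilter.of_def ⟨⊤, ?_⟩ (fun a ha b hb => ⟨a ⊓ b, ?_, inf_le_left, inf_le_right⟩)
    fun hab ha => Filter.mem_of_superset ha (basicSet_subset_iff.2 hab)
  · exact Filter.mem_of_superset Filter.univ_mem fun ω _ => PFilter.top_mem
  · change basicSet (a ⊓ b) ∈ 𝓕
    exact basicSet_inf a b ▸ Filter.inter_mem ha hb

instance : CompactSpace (StoneSpace B) := by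
  refine ⟨isCompact_iff_ultrafilter_le_nhds.2 fun 𝒰 _ => ?_⟩
  let F : PFilter B := (isPFilter_setOf_basicSet_mem (𝒰 : Filter (StoneSpace B))).toPFilter
  have hmem (b : B) : b ∈ F ↔ basicSet b ∈ 𝒰 := Iff.rfl
  have hbot : ⊥ ∉ F := fun h =>
    let ⟨ω, hω⟩ := 𝒰.nonempty_of_mem h
    ω.bot_notMem hω
  have hcompl (b : B) : b ∈ F ∨ bᶜ ∈ F := by
    rw [hmem, hmem, ← compl_basicSet]
    exact 𝒰.mem_or_compl_mem _
  refine ⟨⟨F, maximal_of_mem_or_compl_mem hbot hcompl⟩, trivial, fun S hS => ?_⟩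
  obtain ⟨_, ⟨b, rfl⟩, hb, hbS⟩ := isTopologicalBasis_basicSet.mem_nhds_iff.1 hS
  exact Filter.mem_of_superset hb hbS

theorem exists_basicSet_eq (U : Clopens (StoneSpace B)) :
    ∃ b : B, basicSet b = (U : Set (StoneSpace B)) := by
  obtain ⟨s, hs, hU⟩ := eq_finite_iUnion_of_isTopologicalBasis_of_isCompact_open _
    isTopologicalBasis_basicSet (U : Set (StoneSpace B)) U.isClosed.isCompact U.isOpen
  refine ⟨hs.toFinset.sup id, Set.ext fun ω => ?_⟩
  change hs.toFinset.sup id ∈ ω.1 ↔ _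
  simp only [finset_sup_mem_iff, hU, Set.Finite.mem_toFinset, Set.mem_iUnion, exists_prop, id]
  rfl

/-- Stone's representation of `B` as the algebra of clopen subsets of its Stone space. -/
noncomputable def clopensIso (B : Type*) [BooleanAlgebra B] : B ≃o Clopens (StoneSpace B) :=
  RelIso.ofSurjective
    (OrderEmbedding.ofMapLEIff (fun b : B => (⟨basicSet b, isClopen_basicSet b⟩ : Clopens _))
      fun _ _ => basicSet_subset_iff)
    fun U => (exists_basicSet_eq U).imp fun _ h => Clopens.ext h

end StoneSpace

section Points

open Order

variable {E : Type*} [TopologicalSpace E]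

/-- The ultrafilter of the clopen sets that contain a given point. -/
def pointUltrafilter (x : E) : StoneSpace (Clopens E) :=
  let hF : IsPFilter {U : Clopens E | x ∈ U} := .of_def ⟨⊤, trivial⟩
    (fun U hU V hV => ⟨U ⊓ V, ⟨hU, hV⟩, inf_le_left, inf_le_right⟩) fun hUV hU => hUV hU
  ⟨hF.toPFilter, StoneSpace.maximal_of_mem_or_compl_mem (fun h => h) fun U => em (x ∈ U)⟩

theorem mem_pointUltrafilter {x : E} {U : Clopens E} : U ∈ (pointUltrafilter x).1 ↔ x ∈ U :=
  Iff.rfl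

theorem continuous_pointUltrafilter : Continuous (pointUltrafilter : E → _) :=
  continuous_generateFrom_iff.2 <| by
    rintro _ ⟨U, rfl⟩
    exact U.isOpen

theorem pointUltrafilter_injective [TotallySeparatedSpace E] :
    Function.Injective (pointUltrafilter : E → _) := by
  intro x y hxy
  by_contra hne
  obtain ⟨V, hV, hxV, hyV⟩ := exists_isClopen_of_totally_separated hne
  have hx : ⟨V, hV⟩ ∈ (pointUltrafilter x).1 := hxV
  rw [hxy] at hx
  exact hyV hx

theorem pointUltrafilter_surjective [CompactSpace E] :
    Function.Surjective (pointUltrafilter : E → _) := by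
  intro ω
  have hne : Nonempty ω.1 := ω.1.nonempty.to_subtype
  obtain ⟨x, hx⟩ : (⋂ U : ω.1, ((U : Clopens E) : Set E)).Nonempty := by
    refine IsCompact.nonempty_iInter_of_directed_nonempty_isCompact_isClosed _ (fun U V => ?_)
      (fun U => ?_) (fun U => U.1.isClosed.isCompact) fun U => U.1.isClosed
    · exact ⟨⟨U ⊓ V, PFilter.inf_mem U.2 V.2⟩, Set.inter_subset_left, Set.inter_subset_right⟩
    · rw [Set.nonempty_iff_ne_empty]
      exact fun hU => ω.bot_notMem ((Clopens.ext hU : U.1 = ⊥) ▸ U.2)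
  have hle : ω.1 ≤ (pointUltrafilter x).1 := fun U hU => Set.mem_iInter.1 hx ⟨U, hU⟩
  exact ⟨x, Subtype.ext ((ω.2.2 (pointUltrafilter x).2.1 hle).antisymm hle)⟩

variable [TotallySeparatedSpace E]

theorem clopenAction_injective : Function.Injective (clopenAction E) := by
  rw [injective_iff_map_eq_one]
  intro f hf
  refine Homeomorph.ext fun x => pointUltrafilter_injective <| Subtype.ext ?_
  ext U
  have hU : imageClopen f U = U := DFunLike.congr_fun hf U
  calc f x ∈ U ↔ f x ∈ imageClopen f U := by rw [hU]
    _ ↔ x ∈ U := f.injective.mem_set_image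

variable [CompactSpace E]

/-- A Stone space is the Stone space of its algebra of clopen subsets. -/
noncomputable def pointHomeomorph : E ≃ₜ StoneSpace (Clopens E) :=
  continuous_pointUltrafilter.homeoOfEquivCompactToT2
    (f := .ofBijective pointUltrafilter ⟨pointUltrafilter_injective, pointUltrafilter_surjective⟩)

theorem clopenAction_surjective : Function.Surjective (clopenAction E) := by
  intro φ
  let f : E ≃ₜ E := pointHomeomorph.trans ((stoneAction _ φ).trans pointHomeomorph.symm)
  have hf (x : E) (U : Clopens E) : f x ∈ φ U ↔ x ∈ U := by
    have hfx : pointUltrafilter (f x) = mapUltrafilter φ (pointUltrafilter x) :=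
      pointHomeomorph.apply_symm_apply _
    rw [← mem_pointUltrafilter, hfx]
    exact φ.injective.mem_set_image
  refine ⟨f, RelIso.ext fun U => SetLike.ext fun y => ?_⟩
  obtain ⟨x, rfl⟩ := f.surjective y
  exact f.injective.mem_set_image.trans (hf x U).symm

end Points

section CompactOpen

variable {E : Type*} [TopologicalSpace E] {f : E ≃ₜ E}

theorem imageClopen_eq_iff {U V : Clopens E} :
    imageClopen f U = V ↔ Set.MapsTo f U V ∧ Set.MapsTo f (U : Set E)ᶜ (V : Set E)ᶜ := by
  rw [Set.mapsTo_iff_image_subset, Set.mapsTo_iff_image_subset, Set.image_compl_eq f.bijective,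
    Set.compl_subset_compl, ← Set.Subset.antisymm_iff]
  exact SetLike.ext'_iff

theorem continuous_clopenAction [CompactSpace E] : Continuous (clopenAction E) := by
  refine (permutationTopology_continuous_iff _).2 fun U V => ?_
  have hset : {f : E ≃ₜ E | clopenAction E f U = V} =
      (fun f : E ≃ₜ E => (⟨f, f.continuous⟩ : C(E, E))) ⁻¹'
        ({g | Set.MapsTo g U V} ∩ {g | Set.MapsTo g (U : Set E)ᶜ (V : Set E)ᶜ}) :=
    Set.ext fun f => imageClopen_eq_iff
  rw [hset]
  exact ((ContinuousMap.isOpen_setOfPred_mapsTo U.isClosed.isCompact V.isOpen).inter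
    (ContinuousMap.isOpen_setOfPred_mapsTo (Uᶜ).isClosed.isCompact (Vᶜ).isOpen)).preimage
    continuous_induced_dom

variable [CompactSpace E] [T2Space E] [TotallyDisconnectedSpace E]

theorem exists_clopens_forall_mapsTo {K W : Set E} (hK : IsCompact K) (hW : IsOpen W)
    (hf : Set.MapsTo f K W) :
    ∃ U : Clopens E, ∀ g : E ≃ₜ E, imageClopen g U = imageClopen f U → Set.MapsTo g K W := by
  obtain ⟨V, hV, hKV, hVW⟩ := exists_clopen_of_closed_subset_open
    (hK.isClosed) (hW.preimage f.continuous) hf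
  refine ⟨⟨V, hV⟩, fun g hg x hx => ?_⟩
  obtain ⟨y, hy, hyx⟩ : g x ∈ imageClopen f ⟨V, hV⟩ := hg ▸ ⟨x, hKV hx, rfl⟩
  exact hyx ▸ hVW hy

theorem isInducing_clopenAction : Topology.IsInducing (clopenAction E) := by
  refine Topology.isInducing_iff_nhds.2 fun f =>
    le_antisymm (continuous_clopenAction.tendsto f).le_comap (le_of_le_of_eq ?_
      (nhds_induced _ f).symm)
  rw [ContinuousMap.nhds_compactOpen]
  simp only [Filter.comap_iInf, Filter.comap_principal, le_iInf_iff, Filter.le_principal_iff]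
  intro K hK W hW hf
  obtain ⟨U, hU⟩ := exists_clopens_forall_mapsTo hK hW hf
  have hopen := permutationTopology_isOpen (r := (· ≤ ·)) U (clopenAction E f U)
  exact ⟨_, hopen.mem_nhds rfl, fun g hg => hU g hg⟩

theorem isTopGroupIso_clopenAction : IsTopGroupIso (clopenAction E) :=
  .of_isInducing ⟨clopenAction_injective, clopenAction_surjective⟩ isInducing_clopenAction

end CompactOpen

section Conjugation

variable {B C : Type*} [BooleanAlgebra B] [BooleanAlgebra C]

/-- Conjugation by an order isomorphism, which transports automorphisms of `B` to `C`. -/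
def conjAut (e : B ≃o C) : (B ≃o B) →* (C ≃o C) where
  toFun φ := (e.symm.trans φ).trans e
  map_one' := RelIso.ext fun x => e.apply_symm_apply x
  map_mul' φ _ := RelIso.ext fun _ => congrArg (e ∘ φ) (e.symm_apply_apply _).symm

theorem conjAut_conjAut_symm (e : B ≃o C) (φ : C ≃o C) : conjAut e (conjAut e.symm φ) = φ :=
  RelIso.ext fun x => by
    change e (e.symm (φ (e (e.symm x)))) = φ x
    simp only [OrderIso.apply_symm_apply]

theorem continuous_conjAut (e : B ≃o C) : Continuous (conjAut e) := by
  refine (permutationTopology_continuous_iff _).2 fun x y => ?_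
  have hset : {φ : B ≃o B | conjAut e φ x = y} = {φ : B ≃o B | φ (e.symm x) = e.symm y} :=
    Set.ext fun _ => (e.eq_symm_apply).symm
  exact hset ▸ permutationTopology_isOpen _ _

theorem isTopGroupIso_conjAut (e : B ≃o C) : IsTopGroupIso (conjAut e) :=
  ⟨{ conjAut e with
      invFun := conjAut e.symm
      left_inv := conjAut_conjAut_symm e.symm
      right_inv := conjAut_conjAut_symm e
      continuous_toFun := continuous_conjAut e
      continuous_invFun := continuous_conjAut e.symm }, fun _ => rfl⟩

theorem clopenAction_comp_stoneAction (B : Type*) [BooleanAlgebra B] :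
    (clopenAction (StoneSpace B)).comp (stoneAction B) = conjAut (StoneSpace.clopensIso B) := by
  refine MonoidHom.ext fun φ => RelIso.ext fun U => ?_
  obtain ⟨b, rfl⟩ := (StoneSpace.clopensIso B).surjective U
  change imageClopen (stoneAction B φ) (StoneSpace.clopensIso B b) =
    StoneSpace.clopensIso B (φ ((StoneSpace.clopensIso B).symm (StoneSpace.clopensIso B b)))
  rw [OrderIso.symm_apply_apply]
  refine SetLike.ext fun ω => ?_
  obtain ⟨ω, rfl⟩ := (stoneAction B φ).surjective ω
  calc _ ↔ b ∈ ω.1 := (stoneAction B φ).injective.mem_set_image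
    _ ↔ φ b ∈ (mapUltrafilter φ ω).1 := φ.injective.mem_set_image.symm

theorem isTopGroupIso_stoneAction (B : Type*) [BooleanAlgebra B] : IsTopGroupIso (stoneAction B) :=
  isTopGroupIso_clopenAction.of_comp
    (clopenAction_comp_stoneAction B ▸ isTopGroupIso_conjAut _)

end Conjugation

end StoneDuality

section Metric

variable {B : Type*} [BooleanAlgebra B]

theorem HasFivePoints.exists_sides_isThick_inf (h : HasFivePoints B) (u v : CutVertex B) :
    ∃ a b : Side B, a.cut = u ∧ b.cut = v ∧ IsThick (a ⊓ b : B) := by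
  obtain ⟨a, rfl⟩ := Side.cut_surjective u
  obtain ⟨b, rfl⟩ := Side.cut_surjective v
  have hcover : (a ⊓ b ⊔ a ⊓ (b : B)ᶜ ⊔ (a : B)ᶜ ⊓ b ⊔ (a : B)ᶜ ⊓ (b : B)ᶜ : B) = ⊤ := by
    rw [sup_assoc, ← inf_sup_left, ← inf_sup_left, sup_compl_eq_top, inf_top_eq, inf_top_eq,
      sup_compl_eq_top]
  rcases h _ _ _ _ hcover with hab | hab | hab | hab
  · exact ⟨a, b, rfl, rfl, hab⟩
  · exact ⟨a, bᶜ, rfl, b.cut_compl, hab⟩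
  · exact ⟨aᶜ, b, a.cut_compl, rfl, hab⟩
  · exact ⟨aᶜ, bᶜ, a.cut_compl, b.cut_compl, hab⟩

theorem Side.edist_cut_le_one {a b : Side B} (hab : a ≤ b) :
    (cutComplex B).edist a.cut b.cut ≤ 1 := by
  rw [SimpleGraph.edist_le_one_iff_adj_or_eq]
  rcases hab.lt_or_eq with hlt | rfl
  · exact Or.inl (adj_cut_iff.2 (Or.inl ⟨a, hlt, rfl⟩))
  · exact Or.inr rfl

namespace HasFivePoints

theorem edist_le_two (h : HasFivePoints B) (u v : CutVertex B) : (cutComplex B).edist u v ≤ 2 := by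
  obtain ⟨a, b, rfl, rfl, hab⟩ := h.exists_sides_isThick_inf u v
  let c : Side B := ⟨a ⊓ b, hab, a.isThick_compl_of_le inf_le_left⟩
  have hca : c ≤ a := Subtype.coe_le_coe.1 inf_le_left
  have hcb : c ≤ b := Subtype.coe_le_coe.1 inf_le_right
  calc (cutComplex B).edist a.cut b.cut
      ≤ (cutComplex B).edist a.cut c.cut + (cutComplex B).edist c.cut b.cut :=
        SimpleGraph.edist_triangle
    _ ≤ 1 + 1 := by
        rw [SimpleGraph.edist_comm]
        exact add_le_add (Side.edist_cut_le_one hca) (Side.edist_cut_le_one hcb)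
    _ = 2 := one_add_one_eq_two

theorem exists_crosses (h : HasFivePoints B) : ∃ u v : CutVertex B, Crosses u.1 v.1 := by
  obtain ⟨a⟩ := h.nonempty_side
  obtain ⟨b, hb⟩ := h.exists_side_lt a
  rcases hb with hb | hb
  all_goals
    obtain ⟨x, -, hxb, -⟩ := Side.exists_lt_crosses hb hb
    exact ⟨x.cut, b.cut, hxb⟩

theorem ediam_cutComplex (h : HasFivePoints B) : (cutComplex B).ediam = 2 := by
  refine (SimpleGraph.ediam_le_of_edist_le h.edist_le_two).antisymm ?_
  obtain ⟨u, v, huv⟩ := h.exists_crosses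
  obtain ⟨hne, hadj⟩ := (SimpleGraph.compl_adj _ _ _).1 (compl_cutComplex_adj_iff.2 huv)
  have hdist : ¬ (cutComplex B).edist u v ≤ 1 := fun hle =>
    (SimpleGraph.edist_le_one_iff_adj_or_eq.1 hle).elim hadj hne
  calc (2 : ℕ∞) = 1 + 1 := one_add_one_eq_two.symm
    _ ≤ (cutComplex B).edist u v := Order.add_one_le_of_lt (not_le.1 hdist)
    _ ≤ (cutComplex B).ediam := SimpleGraph.edist_le_ediam

theorem connected_cutComplex (h : HasFivePoints B) : (cutComplex B).Connected :=
  have : Nonempty (CutVertex B) := h.nonempty_side.map Side.cut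
  SimpleGraph.connected_of_ediam_ne_top (h.ediam_cutComplex ▸ ENat.ofNat_ne_top 2)

end HasFivePoints

end Metric

section Cardinality

variable {B : Type*} [BooleanAlgebra B]

theorem Side.exists_surjective_cutVertex_prod_bool (B : Type*) [BooleanAlgebra B] :
    ∃ f : CutVertex B × Bool → Side B, Function.Surjective f := by
  choose g hg using cut_surjective (B := B)
  refine ⟨fun x => if x.2 then g x.1 else (g x.1)ᶜ, fun a => ?_⟩
  rcases cut_eq_iff.1 (hg a.cut).symm with ha | ha
  · exact ⟨(a.cut, true), ha.symm⟩
  · exact ⟨(a.cut, false), ha.symm⟩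

theorem HasFivePoints.finite_cutVertex_iff (h : HasFivePoints B) :
    Finite (CutVertex B) ↔ Finite B := by
  refine ⟨fun _ => ?_, fun _ => Finite.of_surjective _ Side.cut_surjective⟩
  obtain ⟨f, hf⟩ := Side.exists_surjective_cutVertex_prod_bool B
  have : Finite (Side B) := Finite.of_surjective f hf
  exact Finite.of_surjective _ h.exists_finset_sup_inf_eq

theorem HasFivePoints.countable_cutVertex_iff (h : HasFivePoints B) :
    Countable (CutVertex B) ↔ Countable B := by
  refine ⟨fun _ => ?_, fun _ => Side.cut_surjective.countable⟩
  obtain ⟨f, hf⟩ := Side.exists_surjective_cutVertex_prod_bool B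
  have : Countable (Side B) := hf.countable
  exact Function.Surjective.countable h.exists_finset_sup_inf_eq

variable {E : Type*} [TopologicalSpace E]

theorem finite_clopens_iff [TotallySeparatedSpace E] : Finite (Clopens E) ↔ Finite E := by
  constructor
  · intro
    have hinj : Function.Injective fun x : E => ((pointUltrafilter x).1 : Set (Clopens E)) :=
      fun _ _ hxy => pointUltrafilter_injective (Subtype.ext (SetLike.coe_injective hxy))
    exact Finite.of_injective _ hinj
  · intro
    exact Finite.of_injective _ SetLike.coe_injective

variable [CompactSpace E] [T2Space E] [TotallyDisconnectedSpace E]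

theorem isThick_clopens_iff {U : Clopens E} : IsThick U ↔ (U : Set E).Nontrivial := by
  simpa [IsNonperipheral, IsThick] using isNonperipheral_clopens_iff s(U, U)

theorem hasFivePoints_clopens (h : 5 ≤ ENat.card E) : HasFivePoints (Clopens E) := by
  intro U V W X hcover
  by_contra! hthin
  simp only [isThick_clopens_iff, ← Set.one_lt_encard_iff_nontrivial, not_lt] at hthin
  obtain ⟨hU, hV, hW, hX⟩ := hthin
  have hunion : (U ∪ V ∪ W ∪ X : Set E) = Set.univ := congrArg SetLike.coe hcover
  have hle : ENat.card E ≤ 4 := calc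
    ENat.card E = (U ∪ V ∪ W ∪ X : Set E).encard := by rw [hunion, Set.encard_univ]
    _ ≤ (U : Set E).encard + (V : Set E).encard + (W : Set E).encard + (X : Set E).encard := by
        grw [Set.encard_union_le, Set.encard_union_le, Set.encard_union_le]
    _ ≤ 1 + 1 + 1 + 1 := by gcongr
    _ = 4 := by norm_num
  exact absurd (h.trans hle) (by decide)

end Cardinality

theorem mainTheorem1_general :
    (∀ (E : Type*) [TopologicalSpace E] [CompactSpace E] [T2Space E] [TotallyDisconnectedSpace E],
      5 ≤ ENat.card E →
      IsTopGroupIso (homeoCutAction E) ∧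
      IsTopGroupIso (clopenAction E) ∧
      (cutComplex (Clopens E)).Connected ∧
      (cutComplex (Clopens E)).ediam = 2 ∧
      (Finite (CutVertex (Clopens E)) ↔ Finite E) ∧
      (Countable (CutVertex (Clopens E)) ↔ SecondCountableTopology E)) ∧
    (∀ (B : Type*) [BooleanAlgebra B], 5 ≤ ENat.card (StoneSpace B) →
      IsTopGroupIso (autCutAction B) ∧
      IsTopGroupIso (stoneAction B)) := by
  refine ⟨fun E _ _ _ _ hE => ?_, fun B _ hB => ?_⟩
  · have h : HasFivePoints (Clopens E) := hasFivePoints_clopens hE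
    exact ⟨h.isTopGroupIso_autCutAction.comp isTopGroupIso_clopenAction,
      isTopGroupIso_clopenAction, h.connected_cutComplex, h.ediam_cutComplex,
      h.finite_cutVertex_iff.trans finite_clopens_iff,
      h.countable_cutVertex_iff.trans Clopens.countable_iff_secondCountable⟩
  · have h : HasFivePoints B :=
      (hasFivePoints_clopens hB).of_orderIso (StoneSpace.clopensIso B).symm
    exact ⟨h.isTopGroupIso_autCutAction, isTopGroupIso_stoneAction B⟩

theorem mainTheorem1 :
    (∀ (E : Type*) [TopologicalSpace E] [CompactSpace E] [T2Space E] [TotallyDisconnectedSpace E]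
        [SecondCountableTopology E], 5 ≤ ENat.card E →
      IsTopGroupIso (homeoCutAction E) ∧
      IsTopGroupIso (clopenAction E) ∧
      (cutComplex (Clopens E)).Connected ∧
      (Finite E → Finite (CutVertex (Clopens E)) ∧ (cutComplex (Clopens E)).ediam ≤ 4) ∧
      (Infinite E → Countable (CutVertex (Clopens E)) ∧ Infinite (CutVertex (Clopens E)) ∧
        (cutComplex (Clopens E)).ediam = 2)) ∧
    (∀ (B : Type*) [BooleanAlgebra B] [Countable B], 5 ≤ ENat.card (StoneSpace B) →
      IsTopGroupIso (autCutAction B) ∧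
      IsTopGroupIso (stoneAction B)) := by
  obtain ⟨hspace, halgebra⟩ := mainTheorem1_general
  refine ⟨fun E _ _ _ _ _ h5 => ?_, fun B _ _ h5 => halgebra B h5⟩
  obtain ⟨hcut, hclopen, hconn, hdiam, hfin, hcount⟩ := hspace E h5
  exact ⟨hcut, hclopen, hconn, fun hE => ⟨hfin.2 hE, hdiam.trans_le (by norm_num)⟩,
    fun hE => ⟨hcount.2 inferInstance, not_finite_iff_infinite.1 (mt hfin.1 hE.not_finite), hdiam⟩⟩
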